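/- Call a group $G$ \emph{left orderable} if it admits a total order $\prec$ such that $g\prec h$ if and only if $fg\prec fh$, for all $f,g,h\in G$, and \emph{locally indicable} if every nontrivial finitely generated subgroup of $G$ admits a surjective homomorphism onto $\mathbb Z$. A PL $n$-manifold (possibly with boundary) is a Hausdorff space with charts onto open subsets of the closed half-space of $\mathbb R^n$ whose transition functions are piecewise linear. Let $M$ be a connected, oriented PL $n$-manifold, possibly with boundary, and let $K\subseteq M$ be a nonempty closed subset which is a PL submanifold (possibly with boundary) of codimension at most $1$; that is, for some $m\ge n-1$, every point of $K$ has a neighbourhood in $K$ that is the homeomorphic image, under a piecewise linear map into $M$, of an open subset of the closed half-space of $\mathbb R^m$. Then the group $\mathrm{PL}_+(M,K)$ of orientation-preserving PL self-homeomorphisms of $M$ that fix $K$ pointwise is locally indicable, and it is left orderable. In particular, for every $n\ge 0$, the group $\mathrm{PL}(I^n,\partial I^n)$ of PL self-homeomorphisms of the cube $I^n=[-1,1]^n$ that fix the boundary $\partial I^n$ pointwise is locally indicable and left orderable. -/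

import Mathlib

open Set Filter Topology

/-! ### Ordered and indicable groups -/

/-- A group is left orderable if it carries a total order invariant under left multiplication. -/
def IsLeftOrderable (G : Type*) [Group G] : Prop :=
  ∃ _ : LinearOrder G, ∀ f g h : G, g < h ↔ f * g < f * h

/-- A group is locally indicable if each nontrivial finitely generated subgroup surjects
onto `ℤ`. -/
def IsLocallyIndicable (G : Type*) [Group G] : Prop :=
  ∀ H : Subgroup G, H.FG → H ≠ ⊥ → ∃ φ : H →* Multiplicative ℤ, Function.Surjective φ

namespace PLTop

/-! ### Piecewise linear maps between subsets of `ℝⁿ` -/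

/-- A closed convex polyhedron in `ℝⁿ`: an intersection of finitely many closed half-spaces. -/
def IsPolyhedron {n : ℕ} (P : Set (Fin n → ℝ)) : Prop :=
  ∃ S : Set ((Fin n → ℝ) →ᵃ[ℝ] ℝ), S.Finite ∧ P = {x | ∀ a ∈ S, 0 ≤ a x}

/-- The map `f` agrees with the affine map `A` on a neighbourhood of `x`. -/
def HasAffineGerm {m n : ℕ} {X : Set (Fin m → ℝ)} {Y : Set (Fin n → ℝ)} (f : X → Y) (x : X)
    (A : (Fin m → ℝ) →ᵃ[ℝ] (Fin n → ℝ)) : Prop :=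
  ∀ᶠ y : X in 𝓝 x, (f y : Fin n → ℝ) = A y

/-- `f : X → Y` is piecewise linear near `x`: some neighbourhood of `x` in `X` is covered by
finitely many closed convex polyhedra, on each of which `f` is affine near `x`. (Cutting with a
small cube around `x` and triangulating, this says that when `X` is itself a polyhedron, `x` has
a compact polyhedral neighbourhood which is subdivided into finitely many simplices on each of
which `f` is affine.) -/
def IsPLAt {m n : ℕ} {X : Set (Fin m → ℝ)} {Y : Set (Fin n → ℝ)} (f : X → Y) (x : X) : Prop :=
  ∃ F : Set (Set (Fin m → ℝ)), F.Finite ∧ (∀ P ∈ F, IsPolyhedron P) ∧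
    (∀ P ∈ F, ∃ A : (Fin m → ℝ) →ᵃ[ℝ] (Fin n → ℝ),
      ∀ᶠ y : X in 𝓝 x, (y : Fin m → ℝ) ∈ P → (f y : Fin n → ℝ) = A y) ∧
    ∀ᶠ y : X in 𝓝 x, ∃ P ∈ F, (y : Fin m → ℝ) ∈ P

section Basic

variable {k m n : ℕ} {X : Set (Fin k → ℝ)} {Y : Set (Fin m → ℝ)} {Z : Set (Fin n → ℝ)}

theorem IsPolyhedron.isClosed {P : Set (Fin n → ℝ)} (h : IsPolyhedron P) : IsClosed P := by
  obtain ⟨S, -, rfl⟩ := h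
  simp only [ofPred_forall]
  exact isClosed_biInter fun a _ =>
    isClosed_le continuous_const a.continuous_of_finiteDimensional

theorem IsPolyhedron.inter_preimage {P : Set (Fin m → ℝ)} {Q : Set (Fin n → ℝ)}
    (hP : IsPolyhedron P) (hQ : IsPolyhedron Q) (A : (Fin m → ℝ) →ᵃ[ℝ] (Fin n → ℝ)) :
    IsPolyhedron (P ∩ A ⁻¹' Q) := by
  obtain ⟨S, hS, rfl⟩ := hP
  obtain ⟨T, hT, rfl⟩ := hQ
  refine ⟨S ∪ (fun a => a.comp A) '' T, hS.union (hT.image _), ?_⟩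
  ext x
  simp only [mem_inter_iff, mem_ofPred_eq, mem_preimage, mem_union]
  constructor
  · rintro ⟨h1, h2⟩ a (ha | ⟨b, hb, rfl⟩)
    · exact h1 a ha
    · exact h2 b hb
  · intro h
    exact ⟨fun a ha => h a (Or.inl ha), fun b hb => h _ (Or.inr ⟨b, hb, rfl⟩)⟩

theorem isPLAt_id (x : X) : IsPLAt (id : X → X) x := by
  refine ⟨{univ}, finite_singleton _, ?_, ?_, ?_⟩
  · rintro P rfl
    exact ⟨∅, finite_empty, by simp⟩
  · intro P hP
    exact ⟨AffineMap.id ℝ _, by simp⟩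
  · simp

theorem IsPLAt.congr {f g : X → Y} {x : X} (hf : IsPLAt f x) (h : ∀ᶠ y : X in 𝓝 x, g y = f y) :
    IsPLAt g x := by
  obtain ⟨F, h1, h2, h3, h4⟩ := hf
  refine ⟨F, h1, h2, fun P hP => ?_, h4⟩
  obtain ⟨A, hA⟩ := h3 P hP
  refine ⟨A, ?_⟩
  filter_upwards [hA, h] with y hy hy' hyP
  rw [hy', hy hyP]

theorem IsPLAt.continuousAt {f : X → Y} {x : X} (hf : IsPLAt f x) : ContinuousAt f x := by
  obtain ⟨F, h1, h2, h3, h4⟩ := hf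
  refine IsInducing.subtypeVal.continuousAt_iff.2 ?_
  intro U hU
  have key : ∀ P ∈ F, ∀ᶠ y : X in 𝓝 x, (y : Fin k → ℝ) ∈ P → (f y : Fin m → ℝ) ∈ U := by
    intro P hP
    by_cases hx : (x : Fin k → ℝ) ∈ P
    · obtain ⟨A, hA⟩ := h3 P hP
      have hc : ContinuousAt (fun y : X => A y) x :=
        (A.continuous_of_finiteDimensional.comp continuous_subtype_val).continuousAt
      have hfx : (f x : Fin m → ℝ) = A x := hA.self_of_nhds hx
      have : ∀ᶠ y : X in 𝓝 x, A y ∈ U := hc (by simpa [hfx] using hU)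
      filter_upwards [hA, this] with y h1 h2 h3
      rw [h1 h3]
      exact h2
    · have : ∀ᶠ y : X in 𝓝 x, (y : Fin k → ℝ) ∈ Pᶜ :=
        continuous_subtype_val.continuousAt
          ((h2 P hP).isClosed.isOpen_compl.mem_nhds hx)
      filter_upwards [this] with y hy hy'
      exact absurd hy' hy
  have := (h1.eventually_all).2 key
  change ∀ᶠ y : X in 𝓝 x, (f y : Fin m → ℝ) ∈ U
  filter_upwards [this, h4] with y hy ⟨P, hP, hyP⟩
  exact hy P hP hyP

theorem IsPLAt.comp {f : X → Y} {g : Y → Z} {x : X} (hg : IsPLAt g (f x)) (hf : IsPLAt f x) :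
    IsPLAt (g ∘ f) x := by
  have hc := hf.continuousAt
  obtain ⟨F, h1, h2, h3, h4⟩ := hf
  obtain ⟨F₂, k1, k2, k3, k4⟩ := hg
  choose! A hA using h3
  choose! B hB using k3
  refine ⟨image2 (fun P Q => P ∩ A P ⁻¹' Q) F F₂, h1.image2 _ k1, ?_, ?_, ?_⟩
  · rintro _ ⟨P, hP, Q, hQ, rfl⟩
    exact (h2 P hP).inter_preimage (k2 Q hQ) _
  · rintro _ ⟨P, hP, Q, hQ, rfl⟩
    refine ⟨(B Q).comp (A P), ?_⟩
    filter_upwards [hA P hP, hc.eventually (hB Q hQ)] with y hy hy' hyy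
    have e := hy hyy.1
    have : (f y : Fin m → ℝ) ∈ Q := by rw [e]; exact hyy.2
    simp [hy' this, e]
  · have hA' := (h1.eventually_all).2 hA
    filter_upwards [h4, hc.eventually k4, hA'] with y ⟨P, hP, hy⟩ ⟨Q, hQ, hy'⟩ hy''
    refine ⟨_, ⟨P, hP, Q, hQ, rfl⟩, hy, ?_⟩
    rw [mem_preimage, ← hy'' P hP hy]
    exact hy'

/-- A piecewise linear map is affine near a dense set of points. -/
theorem IsPLAt.frequently_hasAffineGerm {f : X → Y} {x : X} (hf : IsPLAt f x) :
    ∃ᶠ y in 𝓝 x, ∃ A, HasAffineGerm f y A := by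
  obtain ⟨F, h1, h2, h3, h4⟩ := hf
  choose! A hA using h3
  have hA' := (h1.eventually_all).2 hA
  have hfr : ∀ T : Set (Set (Fin k → ℝ)), T.Finite → (∀ P ∈ T, IsClosed P) →
      IsClosed (⋃ P ∈ T, frontier ((↑) ⁻¹' P : Set X)) ∧
      interior (⋃ P ∈ T, frontier ((↑) ⁻¹' P : Set X)) = ∅ := by
    intro T hT
    induction T, hT using Set.Finite.induction_on with
    | empty => simp
    | @insert P S hP hS ih =>
      intro h
      obtain ⟨ih1, ih2⟩ := ih fun Q hQ => h Q (mem_insert_of_mem _ hQ)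
      rw [biUnion_insert]
      refine ⟨isClosed_frontier.union ih1, ?_⟩
      rw [interior_union_isClosed_of_interior_empty isClosed_frontier ih2]
      exact interior_frontier ((h P (mem_insert _ _)).preimage continuous_subtype_val)
  obtain ⟨-, hint⟩ := hfr F h1 fun P hP => (h2 P hP).isClosed
  rw [frequently_iff]
  intro U hU
  obtain ⟨V, hV, hVo, hxV⟩ := eventually_nhds_iff.1 ((hA'.and h4).and hU)
  have : ¬ V ⊆ ⋃ P ∈ F, frontier ((↑) ⁻¹' P : Set X) := by
    intro hsub
    have := interior_maximal hsub hVo hxV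
    rw [hint] at this
    exact this
  obtain ⟨y, hyV, hy⟩ := not_subset.1 this
  obtain ⟨⟨-, P, hP, hyP⟩, hyU⟩ := hV y hyV
  refine ⟨y, hyU, A P, ?_⟩
  have hyi : y ∈ interior ((↑) ⁻¹' P : Set X) := by
    by_contra hn
    exact hy (mem_biUnion hP ⟨subset_closure hyP, hn⟩)
  filter_upwards [mem_interior_iff_mem_nhds.1 hyi, hVo.mem_nhds hyV] with z hz hzV
  exact (hV z hzV).1.1 P hP hz

end Basic

/-! ### Piecewise linear manifolds, possibly with boundary -/

/-- The closed half-space `{x ∈ ℝⁿ | x₀ ≥ 0}` (a single point if `n = 0`), the local model of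
`n`-dimensional manifolds with boundary. -/
def halfSpace (n : ℕ) : Set (Fin n → ℝ) := {x | ∀ i : Fin n, (i : ℕ) = 0 → 0 ≤ x i}

/-- Piecewise linear maps between open subsets of the half-space. -/
def plPregroupoid (n : ℕ) : Pregroupoid (halfSpace n) where
  property f u := ∀ x ∈ u, IsPLAt f x
  comp hf hg _ _ _ x hx := (hg _ hx.2).comp (hf x hx.1)
  id_mem x _ := isPLAt_id x
  locality _ h x hx := by
    obtain ⟨v, _, hxv, h⟩ := h x hx
    exact h x ⟨hx, hxv⟩
  congr hu h hf x hx := (hf x hx).congr (by filter_upwards [hu.mem_nhds hx] using h)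

/-- The groupoid of piecewise linear homeomorphisms between open subsets of the half-space. A
PL `n`-manifold (possibly with boundary) is a space with charts in `halfSpace n` whose transition
functions lie in this groupoid. -/
def plGroupoid (n : ℕ) : StructureGroupoid (halfSpace n) := (plPregroupoid n).groupoid

/-- The chain rule for the linear parts. -/
theorem hasAffineGerm_comp {n : ℕ} {M : Type*} [TopologicalSpace M] {f g : M ≃ₜ M}
    {c c' c'' : OpenPartialHomeomorph M (halfSpace n)}
    {w : M} (hw : w ∈ c.source) (hw' : g w ∈ c'.source)
    {B C : (Fin n → ℝ) →ᵃ[ℝ] (Fin n → ℝ)}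
    (hB : HasAffineGerm (fun y => c' (g (c.symm y))) (c w) B)
    (hC : HasAffineGerm (fun y => c'' (f (c'.symm y))) (c' (g w)) C) :
    HasAffineGerm (fun y => c'' (f (g (c.symm y)))) (c w) (C.comp B) := by
  have h1 : ContinuousAt (fun y => g (c.symm y)) (c w) :=
    g.continuous.continuousAt.comp (c.continuousAt_symm (c.map_source hw))
  have e : g (c.symm (c w)) = g w := by rw [c.left_inv hw]
  have h2 : ContinuousAt (fun y => c' (g (c.symm y))) (c w) :=
    ContinuousAt.comp (g := c') (by rw [e]; exact c'.continuousAt hw') h1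
  have h3 : ∀ᶠ y in 𝓝 (c w), g (c.symm y) ∈ c'.source :=
    h1 (by simpa only [e] using c'.open_source.mem_nhds hw')
  have h4 := h2.eventually (by simp only [e]; exact hC)
  filter_upwards [hB, h3, h4] with y hy1 hy2 hy3
  rw [c'.left_inv hy2] at hy3
  rw [hy3, hy1]
  rfl

section Manifold

variable (n : ℕ) (M : Type*) [TopologicalSpace M] [ChartedSpace (halfSpace n) M]

/-- The group of piecewise linear self-homeomorphisms of a PL manifold. -/
def PLHomeo [HasGroupoid M (plGroupoid n)] : Subgroup (M ≃ₜ M) where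
  carrier := {f | ∀ c ∈ atlas (halfSpace n) M, ∀ c' ∈ atlas (halfSpace n) M,
    c.symm.trans (f.toOpenPartialHomeomorph.trans c') ∈ plGroupoid n}
  one_mem' c hc c' hc' :=
    (Structomorph.refl (G := plGroupoid n) M).mem_groupoid c c' hc hc'
  mul_mem' {f g} hf hg c hc c' hc' :=
    (Structomorph.trans ⟨g, fun c c' hc hc' => hg c hc c' hc'⟩
      (⟨f, fun c c' hc hc' => hf c hc c' hc'⟩ :
        Structomorph (plGroupoid n) M M)).mem_groupoid c c' hc hc'
  inv_mem' {f} hf c hc c' hc' :=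
    (Structomorph.symm (⟨f, fun c c' hc hc' => hf c hc c' hc'⟩ :
        Structomorph (plGroupoid n) M M)).mem_groupoid c c' hc hc'

/-- An orientation of a PL manifold: each chart `c` of the atlas is given a sign, locally constant
on the source of `c`, saying whether `c` preserves or reverses the orientation there; two such
signs differ by the sign of the Jacobian determinant of the transition function, at each point
near which the transition function is affine (these points are dense). -/
structure PLOrientation where
  /-- `sign c x` is the sign of the chart `c` at the point `x`. -/
  sign : OpenPartialHomeomorph M (halfSpace n) → M → SignType
  sign_ne_zero : ∀ c ∈ atlas (halfSpace n) M, ∀ x ∈ c.source, sign c x ≠ 0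
  continuousOn_sign : ∀ c ∈ atlas (halfSpace n) M, ContinuousOn (sign c) c.source
  sign_eq : ∀ c ∈ atlas (halfSpace n) M, ∀ c' ∈ atlas (halfSpace n) M,
    ∀ x ∈ c.source, x ∈ c'.source → ∀ A, HasAffineGerm (fun y => c' (c.symm y)) (c x) A →
      sign c' x = sign c x * SignType.sign (LinearMap.det A.linear)

variable {n M}

/-- A self-map `f` preserves the orientation `o` if, read in two oriented charts, it has positive
Jacobian determinant wherever it is affine. -/
def PLOrientation.Preserves (o : PLOrientation n M) (f : M → M) : Prop :=
  ∀ c ∈ atlas (halfSpace n) M, ∀ c' ∈ atlas (halfSpace n) M,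
    ∀ x ∈ c.source, f x ∈ c'.source → ∀ A, HasAffineGerm (fun y => c' (f (c.symm y))) (c x) A →
      o.sign c' (f x) = o.sign c x * SignType.sign (LinearMap.det A.linear)

/-- A subset `K` of a PL `n`-manifold `M` is an `m`-dimensional PL submanifold (possibly with
boundary) if near each of its points it is the homeomorphic image of an open subset of the
`m`-dimensional half-space under a PL map to `M`. -/
def IsPLSubmanifold (n m : ℕ) {M : Type*} [TopologicalSpace M] [ChartedSpace (halfSpace n) M]
    (K : Set M) : Prop :=
  ∀ x : K, ∃ φ : OpenPartialHomeomorph K (halfSpace m), x ∈ φ.source ∧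
    ∀ y ∈ φ.target, ∀ c ∈ atlas (halfSpace n) M, (φ.symm y : M) ∈ c.source →
      IsPLAt (fun z => c (φ.symm z : M)) y

theorem linear_eq_of_eventually {A B : (Fin n → ℝ) →ᵃ[ℝ] (Fin n → ℝ)} {x : halfSpace n}
    (h : ∀ᶠ y : halfSpace n in 𝓝 x, A y = B y) : A.linear = B.linear := by
  refine LinearMap.pi_ext' fun i => LinearMap.ext_ring ?_
  have hmem : ∀ t : ℝ, (x : Fin n → ℝ) + |t| • Pi.single i (1 : ℝ) ∈ halfSpace n := by
    intro t j hj
    have := x.2 j hj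
    have h2 : 0 ≤ |t| * (Pi.single i (1 : ℝ) : Fin n → ℝ) j :=
      mul_nonneg (abs_nonneg t) (by rw [Pi.single_apply]; split_ifs <;> norm_num)
    simpa using add_nonneg this h2
  have hcont : Continuous fun t : ℝ =>
      (⟨(x : Fin n → ℝ) + |t| • Pi.single i (1 : ℝ), hmem t⟩ : halfSpace n) := by
    apply Continuous.subtype_mk
    fun_prop
  have h0 : (⟨(x : Fin n → ℝ) + |(0 : ℝ)| • Pi.single i (1 : ℝ), hmem 0⟩ : halfSpace n) = x := by
    ext; simp
  have h1 : ∀ᶠ t : ℝ in 𝓝 0, A ((x : Fin n → ℝ) + |t| • Pi.single i (1 : ℝ)) =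
      B ((x : Fin n → ℝ) + |t| • Pi.single i (1 : ℝ)) := by
    have h2 : Tendsto (fun t : ℝ =>
        (⟨(x : Fin n → ℝ) + |t| • Pi.single i (1 : ℝ), hmem t⟩ : halfSpace n)) (𝓝 0) (𝓝 x) := by
      have := hcont.tendsto 0
      rwa [h0] at this
    exact h2.eventually h
  obtain ⟨t, ht, ht0⟩ := ((h1.filter_mono nhdsWithin_le_nhds).and
    (self_mem_nhdsWithin : Ioi (0 : ℝ) ∈ 𝓝[>] (0 : ℝ))).exists
  have ht0' : (0 : ℝ) < t := ht0
  have hx := h.self_of_nhds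
  simp only [abs_of_pos ht0'] at ht
  have e : ∀ C : (Fin n → ℝ) →ᵃ[ℝ] (Fin n → ℝ), C ((x : Fin n → ℝ) + t • Pi.single i (1 : ℝ)) =
      t • C.linear (Pi.single i 1) + C x := by
    intro C
    rw [add_comm, ← vadd_eq_add, C.map_vadd, map_smul, vadd_eq_add]
  rw [e, e, hx] at ht
  have := smul_right_injective _ ht0'.ne' (add_right_cancel ht)
  simpa using this

theorem PLOrientation.eventually_sign_eq (o : PLOrientation n M)
    {c : OpenPartialHomeomorph M (halfSpace n)} (hc : c ∈ atlas (halfSpace n) M) {f : M → M}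
    (hf : Continuous f) {x : M} (hx : f x ∈ c.source) :
    ∀ᶠ w in 𝓝 x, o.sign c (f w) = o.sign c (f x) := by
  have h := ((o.continuousOn_sign c hc).continuousAt (c.open_source.mem_nhds hx)).eventually
    (show ∀ᶠ s in 𝓝 (o.sign c (f x)), s = o.sign c (f x) by simp [nhds_discrete])
  exact hf.continuousAt.eventually h

theorem PLOrientation.preserves_id (o : PLOrientation n M) : o.Preserves id :=
  fun c hc c' hc' x hx hx' A hA => o.sign_eq c hc c' hc' x hx hx' A hA

variable [HasGroupoid M (plGroupoid n)]

theorem isPLAt_of_mem {f : M ≃ₜ M} (hf : f ∈ PLHomeo n M)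
    {c c' : OpenPartialHomeomorph M (halfSpace n)} (hc : c ∈ atlas (halfSpace n) M)
    (hc' : c' ∈ atlas (halfSpace n) M) {y : halfSpace n} (hy : y ∈ c.target)
    (hy' : f (c.symm y) ∈ c'.source) : IsPLAt (fun z => c' (f (c.symm z))) y :=
  (hf c hc c' hc').1 y ⟨hy, by simp, by simpa using hy'⟩

/-- Near each point there are points at which both factors of a composition are affine. -/
theorem frequently_affine_comp {f g : M ≃ₜ M} (hf : f ∈ PLHomeo n M) (hg : g ∈ PLHomeo n M)
    {c c' c'' : OpenPartialHomeomorph M (halfSpace n)} (hc : c ∈ atlas (halfSpace n) M)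
    (hc' : c' ∈ atlas (halfSpace n) M) (hc'' : c'' ∈ atlas (halfSpace n) M) {x : M}
    (hx : x ∈ c.source) (hx' : g x ∈ c'.source) (hx'' : f (g x) ∈ c''.source) :
    ∃ᶠ w in 𝓝 x, ∃ B C, HasAffineGerm (fun y => c' (g (c.symm y))) (c w) B ∧
      HasAffineGerm (fun y => c'' (f (c'.symm y))) (c' (g w)) C := by
  rw [frequently_iff]
  intro U hU
  have hgood : ∀ᶠ w in 𝓝 x, w ∈ c.source ∧ g w ∈ c'.source ∧ f (g w) ∈ c''.source ∧ w ∈ U := by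
    filter_upwards [c.open_source.mem_nhds hx,
      g.continuous.continuousAt (c'.open_source.mem_nhds hx'),
      (f.continuous.comp g.continuous).continuousAt (c''.open_source.mem_nhds hx''),
      hU] with w h1 h2 h3 h4 using ⟨h1, h2, h3, h4⟩
  have hgood' := hgood.eventually_nhds
  -- a point near which `g` is affine
  have hc1 : ContinuousAt c.symm (c x) := c.continuousAt_symm (c.map_source hx)
  have hpull : ∀ᶠ y in 𝓝 (c x), y ∈ c.target ∧ ∀ᶠ w in 𝓝 (c.symm y),
      w ∈ c.source ∧ g w ∈ c'.source ∧ f (g w) ∈ c''.source ∧ w ∈ U := by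
    have h1 : Tendsto c.symm (𝓝 (c x)) (𝓝 x) := by
      have := hc1.tendsto
      rwa [c.left_inv hx] at this
    filter_upwards [c.open_target.mem_nhds (c.map_source hx), h1.eventually hgood'] with y h1 h2
      using ⟨h1, h2⟩
  obtain ⟨y, ⟨B, hB⟩, hyt, hyg⟩ := ((isPLAt_of_mem hg hc hc' (c.map_source hx)
    (by rwa [c.left_inv hx])).frequently_hasAffineGerm.and_eventually hpull).exists
  obtain ⟨w, hw⟩ : ∃ w, w = c.symm y := ⟨_, rfl⟩
  rw [← hw] at hyg
  obtain ⟨hw1, hw2, hw3, -⟩ := hyg.self_of_nhds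
  have hyw : y = c w := by rw [hw, c.right_inv hyt]
  -- a nearby point near whose image `f` is affine
  have hz0 : c' (g w) ∈ c'.target := c'.map_source hw2
  have hcont : ContinuousAt (fun z => g.symm (c'.symm z)) (c' (g w)) :=
    g.symm.continuous.continuousAt.comp (c'.continuousAt_symm hz0)
  have hval : g.symm (c'.symm (c' (g w))) = w := by simp [c'.left_inv hw2]
  have hB' : ∀ᶠ v in 𝓝 w, HasAffineGerm (fun y => c' (g (c.symm y))) (c v) B := by
    rw [hyw] at hB
    exact (c.continuousAt hw1).eventually (eventually_eventually_nhds.2 hB)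
  have hback : ∀ᶠ z in 𝓝 (c' (g w)), z ∈ c'.target ∧
      (HasAffineGerm (fun y => c' (g (c.symm y))) (c (g.symm (c'.symm z))) B ∧
        g.symm (c'.symm z) ∈ U) := by
    have h0 : Tendsto (fun z => g.symm (c'.symm z)) (𝓝 (c' (g w))) (𝓝 w) := by
      have := hcont.tendsto
      rwa [hval] at this
    filter_upwards [c'.open_target.mem_nhds hz0, h0.eventually hB', h0.eventually hyg]
      with z h1 h2 h3 using ⟨h1, h2, h3.2.2.2⟩
  obtain ⟨z, ⟨C, hC⟩, hzt, hzB, hzU⟩ := ((isPLAt_of_mem hf hc' hc'' hz0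
    (by rwa [c'.left_inv hw2])).frequently_hasAffineGerm.and_eventually hback).exists
  refine ⟨_, hzU, B, C, hzB, ?_⟩
  simpa [c'.right_inv hzt] using hC

theorem PLOrientation.Preserves.comp {o : PLOrientation n M} {f g : M ≃ₜ M}
    (hf : f ∈ PLHomeo n M) (hg : g ∈ PLHomeo n M) (of : o.Preserves f) (og : o.Preserves g) :
    o.Preserves (f ∘ g) := by
  intro c hc c' hc' x hx hx' A hA
  let d := chartAt (halfSpace n) (g x)
  have hd : d ∈ atlas (halfSpace n) M := chart_mem_atlas _ _
  have hxd : g x ∈ d.source := mem_chart_source _ _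
  have hA' : ∀ᶠ w in 𝓝 x, HasAffineGerm (fun y => c' (f (g (c.symm y)))) (c w) A :=
    (c.continuousAt hx).eventually (eventually_eventually_nhds.2 hA)
  have hw1 : ∀ᶠ w in 𝓝 x, w ∈ c.source := c.open_source.mem_nhds hx
  have hw2 : ∀ᶠ w in 𝓝 x, g w ∈ d.source :=
    g.continuous.continuousAt (d.open_source.mem_nhds hxd)
  have hw3 : ∀ᶠ w in 𝓝 x, f (g w) ∈ c'.source :=
    (f.continuous.comp g.continuous).continuousAt (c'.open_source.mem_nhds hx')
  obtain ⟨w, ⟨B, C, hB, hC⟩, hwA, hw1, hw2, hw3, hs1, hs2⟩ :=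
    ((frequently_affine_comp hf hg hc hd hc' hx hxd hx').and_eventually
      (hA'.and (hw1.and (hw2.and (hw3.and ((o.eventually_sign_eq hc continuous_id hx).and
          (o.eventually_sign_eq hc' (f.continuous.comp g.continuous) hx'))))))).exists
  have e1 := og c hc d hd w hw1 hw2 B hB
  have e2 := of d hd c' hc' (g w) hw2 hw3 C hC
  have hCB := hasAffineGerm_comp hw1 hw2 hB hC
  have hlin : A.linear = (C.comp B).linear := by
    refine linear_eq_of_eventually (x := c w) ?_
    filter_upwards [hwA, hCB] with y h1 h2
    rw [← h1, ← h2]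
  rw [hlin, AffineMap.comp_linear, LinearMap.det_comp, sign_mul, ← hs2, ← id_eq x, ← hs1, id_eq]
  change o.sign c' (f (g w)) = _
  rw [e2, e1]
  simp only [mul_comm, mul_left_comm]

theorem PLOrientation.Preserves.symm {o : PLOrientation n M} {f : M ≃ₜ M}
    (hf : f ∈ PLHomeo n M) (of : o.Preserves f) : o.Preserves f.symm := by
  intro c hc c' hc' x hx hx' A hA
  have hf' : f.symm ∈ PLHomeo n M := (PLHomeo n M).inv_mem hf
  have hA' : ∀ᶠ w in 𝓝 x, HasAffineGerm (fun y => c' (f.symm (c.symm y))) (c w) A :=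
    (c.continuousAt hx).eventually (eventually_eventually_nhds.2 hA)
  have hx'' : f (f.symm x) ∈ c.source := by simpa using hx
  have hw1 : ∀ᶠ w in 𝓝 x, w ∈ c.source := c.open_source.mem_nhds hx
  have hw2 : ∀ᶠ w in 𝓝 x, f.symm w ∈ c'.source :=
    f.symm.continuous.continuousAt (c'.open_source.mem_nhds hx')
  obtain ⟨w, ⟨B, C, hB, hC⟩, hwA, hw1, hw2, hs1, hs2⟩ :=
    ((frequently_affine_comp hf hf' hc hc' hc hx hx' hx'').and_eventually
      (hA'.and (hw1.and (hw2.and ((o.eventually_sign_eq hc continuous_id hx).and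
          (o.eventually_sign_eq hc' f.symm.continuous hx')))))).exists
  have e2 := of c' hc' c hc (f.symm w) hw2 (by simpa using hw1) C hC
  have hCA := hasAffineGerm_comp (f := f) hw1 hw2 hwA hC
  have hlin : (C.comp A).linear = (AffineMap.id ℝ (Fin n → ℝ)).linear := by
    refine linear_eq_of_eventually (x := c w) ?_
    filter_upwards [hCA, c.open_target.mem_nhds (c.map_source hw1)] with y h1 h2
    rw [← h1]
    simp [c.right_inv h2]
  have hdet : LinearMap.det C.linear * LinearMap.det A.linear = 1 := by
    rw [← LinearMap.det_comp, ← AffineMap.comp_linear, hlin]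
    simp
  have hsgn : SignType.sign (LinearMap.det C.linear) * SignType.sign (LinearMap.det A.linear) = 1 := by
    rw [← sign_mul, hdet]; simp
  simp only [id_eq] at hs1
  rw [← hs2, ← hs1]
  rw [f.apply_symm_apply] at e2
  rw [e2, mul_assoc, hsgn, mul_one]

/-- `PL₊(M, K)`: the group of orientation-preserving piecewise linear self-homeomorphisms of the
oriented PL manifold `M` which fix the set `K` pointwise. -/
def PLPlus (o : PLOrientation n M) (K : Set M) : Subgroup (M ≃ₜ M) where
  carrier := {f | f ∈ PLHomeo n M ∧ o.Preserves f ∧ ∀ x ∈ K, f x = x}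
  one_mem' := ⟨(PLHomeo n M).one_mem, o.preserves_id, fun _ _ => rfl⟩
  mul_mem' := by
    rintro f g ⟨hf, of, kf⟩ ⟨hg, og, kg⟩
    refine ⟨(PLHomeo n M).mul_mem hf hg, of.comp hf hg og, fun x hx => ?_⟩
    change f (g x) = x
    rw [kg x hx, kf x hx]
  inv_mem' := by
    rintro f ⟨hf, of, kf⟩
    refine ⟨(PLHomeo n M).inv_mem hf, of.symm hf, fun x hx => ?_⟩
    change f.symm x = x
    rw [Homeomorph.symm_apply_eq, kf x hx]

end Manifold

/-! ### The cube -/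

/-- The cube `Iⁿ = [-1, 1]ⁿ`. -/
def cube (n : ℕ) : Set (Fin n → ℝ) := Icc (-1) 1

/-- `PL(Iⁿ, ∂Iⁿ)`: the group of piecewise linear self-homeomorphisms of the cube which fix its
boundary pointwise. -/
def PLCube (n : ℕ) : Subgroup (cube n ≃ₜ cube n) where
  carrier := {f | (∀ x, IsPLAt f x) ∧ (∀ x, IsPLAt f.symm x) ∧
    ∀ x : cube n, (x : Fin n → ℝ) ∈ frontier (cube n) → f x = x}
  one_mem' := ⟨isPLAt_id, isPLAt_id, fun _ _ => rfl⟩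
  mul_mem' := by
    rintro f g ⟨hf, hf', kf⟩ ⟨hg, hg', kg⟩
    refine ⟨fun x => (hf _).comp (hg x), fun x => (hg' _).comp (hf' x), fun x hx => ?_⟩
    change f (g x) = x
    rw [kg x hx, kf x hx]
  inv_mem' := by
    rintro f ⟨hf, hf', kf⟩
    refine ⟨hf', hf, fun x hx => ?_⟩
    change f.symm x = x
    rw [Homeomorph.symm_apply_eq, kf x hx]

end PLTop

/-! Left orderability follows from local indicability by Burns–Hale, so the task is to map a
nontrivial finitely generated group `H` of PL homeomorphisms onto ℤ. Let `S` be a finite symmetric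
generating set and `F` its common fixed set.

The point is to find `p ∈ F` and a hyperplane `l = 0` through `p`, in a chart, such that near `p`
all generators fix the hyperplane pointwise, are affine on the side `0 ≤ l`, preserve it, and do not
all act trivially there. An affine map fixing the hyperplane is a shear `y ↦ y + l y • u`, and `1 +
l.linear u > 0` when the side is preserved. On germs at `p`, the factor `1 + l.linear u` is
multiplicative; if it is identically `1`, then `u` is additive. Either its logarithm or a coordinate
of `u` is a nontrivial homomorphism to ℝ, whose image is finitely generated and torsion-free, hence
free abelian (`exists_surjective_int_of_shear`).

To find `p`, use that finitely many PL maps have only finitely many walls near a point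
(`exists_common_walls`). If `F` has interior, connectedness gives a frontier point of that interior;
a generic segment near it, running from fixed to moved points, leaves the interior of `F` at a point
lying on at most one wall. One side is then fixed, and injectivity forces the other to be preserved.
If `F` has no interior, `K` contributes a flat patch of codimension one; a generic point of it lies
on no wall other than the patch itself, and preservation of orientation keeps the two sides from
being exchanged.

The cube group embeds into the PL homeomorphisms of the half-space by extension with the identity,
where the first case applies. -/

/-! ### Burns–Hale: from local indicability to left orders -/

/-- In a locally indicable group, signs can be chosen for the elements of a finite set so that
the resulting elements lie in a subsemigroup that does not contain `1`. -/
theorem IsLocallyIndicable.exists_subsemigroup {G : Type*} [Group G] (hG : IsLocallyIndicable G)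
    (S : Finset G) :
    ∃ T : Subsemigroup G, (1 : G) ∉ T ∧ ∀ g ∈ S, g ≠ 1 → g ∈ T ∨ g⁻¹ ∈ T := by
  classical
  induction S using Finset.strongInduction with
  | H S ih =>
    by_cases hS : Subgroup.closure (S : Set G) = ⊥
    · refine ⟨⊥, Subsemigroup.notMem_bot, fun g hg hg1 => absurd ?_ hg1⟩
      have : g ∈ Subgroup.closure (S : Set G) := Subgroup.subset_closure hg
      rwa [hS, Subgroup.mem_bot] at this
    · obtain ⟨H, hH⟩ : ∃ H, H = Subgroup.closure (S : Set G) := ⟨_, rfl⟩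
      rw [← hH] at hS
      obtain ⟨φ, hφ⟩ := hG H ⟨S, hH.symm⟩ hS
      have hmem : ∀ g ∈ S, g ∈ H := fun g hg => hH ▸ Subgroup.subset_closure hg
      -- A surjection cannot kill all generators, so the elements of `S` in the kernel form a
      -- strictly smaller set.
      obtain ⟨s, hs, hφs⟩ : ∃ s, ∃ hs : s ∈ S, φ ⟨s, hmem s hs⟩ ≠ 1 := by
        by_contra! hcon
        have hle : H ≤ φ.ker.map H.subtype := by
          conv_lhs => rw [hH]
          rw [Subgroup.closure_le]
          exact fun s hs => ⟨⟨s, hmem s hs⟩, hcon s hs, rfl⟩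
        obtain ⟨h, hh⟩ := hφ (Multiplicative.ofAdd 1)
        obtain ⟨k, hk, hkh⟩ := hle h.2
        have : k = h := Subtype.ext hkh
        rw [SetLike.mem_coe, MonoidHom.mem_ker, this, hh] at hk
        exact absurd hk (by decide)
      obtain ⟨T, hT1, hT⟩ := ih (S.filter fun g => ∀ hg : g ∈ H, φ ⟨g, hg⟩ = 1)
        (Finset.filter_ssubset.2 ⟨s, hs, fun h => hφs (h _)⟩)
      -- Lexicographic positivity: first by the image under `φ`, then, on the kernel, by the
      -- semigroup `T` of the smaller set.
      refine ⟨⟨{g | ∃ hg : g ∈ H, 1 < φ ⟨g, hg⟩ ∨ φ ⟨g, hg⟩ = 1 ∧ g ∈ T}, ?_⟩, ?_, ?_⟩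
      · rintro a b ⟨ha, ha'⟩ ⟨hb, hb'⟩
        refine ⟨H.mul_mem ha hb, ?_⟩
        have e : φ ⟨a * b, H.mul_mem ha hb⟩ = φ ⟨a, ha⟩ * φ ⟨b, hb⟩ := by
          rw [← map_mul]; rfl
        rw [e]
        rcases ha' with ha' | ⟨ha', haT⟩ <;> rcases hb' with hb' | ⟨hb', hbT⟩
        · exact Or.inl (one_lt_mul'' ha' hb')
        · exact Or.inl (by rwa [hb', mul_one])
        · exact Or.inl (by rwa [ha', one_mul])
        · exact Or.inr ⟨by rw [ha', hb', one_mul], T.mul_mem haT hbT⟩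
      · rintro ⟨h1, h | h⟩
        · have : φ ⟨1, h1⟩ = 1 := map_one φ
          exact absurd h (by rw [this]; exact lt_irrefl _)
        · exact hT1 h.2
      · intro g hg hg1
        have hgH := hmem g hg
        have einv : φ ⟨g⁻¹, H.inv_mem hgH⟩ = (φ ⟨g, hgH⟩)⁻¹ := by rw [← map_inv]; rfl
        rcases lt_trichotomy (φ ⟨g, hgH⟩) 1 with h | h | h
        · exact Or.inr ⟨H.inv_mem hgH, Or.inl (by rw [einv]; exact one_lt_inv'.2 h)⟩
        · rcases hT g (Finset.mem_filter.2 ⟨hg, fun _ => h⟩) hg1 with h' | h'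
          · exact Or.inl ⟨hgH, Or.inr ⟨h, h'⟩⟩
          · exact Or.inr ⟨H.inv_mem hgH, Or.inr ⟨by rw [einv, h, inv_one], h'⟩⟩
        · exact Or.inl ⟨hgH, Or.inl h⟩

/-- A group is left orderable as soon as it has a positive cone. -/
theorem isLeftOrderable_of_subsemigroup {G : Type*} [Group G] (P : Subsemigroup G)
    (h1 : (1 : G) ∉ P) (hP : ∀ g : G, g ≠ 1 → g ∈ P ∨ g⁻¹ ∈ P) : IsLeftOrderable G := by
  classical
  have hinv : ∀ g, g ∈ P → g⁻¹ ∉ P := fun g hg hg' => h1 (by simpa using P.mul_mem hg hg')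
  let po : PartialOrder G :=
    { le := fun g h => g = h ∨ g⁻¹ * h ∈ P
      lt := fun g h => g⁻¹ * h ∈ P
      le_refl := fun g => Or.inl rfl
      le_trans := by
        rintro a b c (rfl | hab) (rfl | hbc)
        · exact Or.inl rfl
        · exact Or.inr hbc
        · exact Or.inr hab
        · exact Or.inr (by simpa [mul_assoc] using P.mul_mem hab hbc)
      lt_iff_le_not_ge := by
        intro a b
        constructor
        · intro hab
          refine ⟨Or.inr hab, ?_⟩
          rintro (rfl | hba)
          · exact h1 (by simpa using hab)
          · exact hinv _ hab (by simpa using hba)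
        · rintro ⟨rfl | hab, h⟩
          · exact absurd (Or.inl rfl) h
          · exact hab
      le_antisymm := by
        rintro a b (rfl | hab) (h | hba)
        · rfl
        · rfl
        · exact h.symm
        · exact absurd (by simpa using hba) (hinv _ hab) }
  refine ⟨{ po with
    le_total := ?_
    toDecidableLE := Classical.decRel _ }, ?_⟩
  · intro a b
    by_cases hab : a = b
    · exact Or.inl (Or.inl hab)
    · rcases hP (a⁻¹ * b) (by simpa [inv_mul_eq_one] using hab) with h | h
      · exact Or.inl (Or.inr h)
      · exact Or.inr (Or.inr (by simpa using h))
  · intro f g h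
    change g⁻¹ * h ∈ P ↔ (f * g)⁻¹ * (f * h) ∈ P
    simp [mul_assoc]

/-- Burns–Hale: locally indicable groups are left orderable. -/
theorem IsLocallyIndicable.isLeftOrderable {G : Type*} [Group G] (hG : IsLocallyIndicable G) :
    IsLeftOrderable G := by
  choose T hT1 hT using hG.exists_subsemigroup
  -- Compactness: the partial cones are glued along an ultrafilter finer than `atTop`, so each `g ≠
  -- 1` is eventually decided by `T S`, and the ultrafilter picks one of the two signs.
  let U : Ultrafilter (Finset G) := Ultrafilter.of atTop
  refine isLeftOrderable_of_subsemigroup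
    ⟨{g | ∀ᶠ S in (U : Filter (Finset G)), g ∈ T S}, ?_⟩ ?_ ?_
  · intro a b ha hb
    filter_upwards [ha, hb] with S h1 h2 using (T S).mul_mem h1 h2
  · intro h
    obtain ⟨S, hS⟩ := Eventually.exists (f := (U : Filter (Finset G))) h
    exact hT1 S hS
  · intro g hg
    have : ∀ᶠ S in (U : Filter (Finset G)), g ∈ T S ∨ g⁻¹ ∈ T S := by
      refine Ultrafilter.of_le atTop ?_
      filter_upwards [eventually_ge_atTop {g}] with S hS
      exact hT S g (hS (Finset.mem_singleton_self g)) hg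
    exact Ultrafilter.eventually_or.1 this

/-! ### Homomorphisms to ℝ and onto ℤ -/

/-- A finitely generated group with a nontrivial homomorphism to `ℝ` surjects onto `ℤ`. -/
theorem exists_surjective_int_of_real {G : Type*} [Group G] (hG : Group.FG G)
    (ψ : G →* Multiplicative ℝ) (hψ : ψ ≠ 1) :
    ∃ φ : G →* Multiplicative ℤ, Function.Surjective φ := by
  have hfg : ψ.range.FG := (Group.fg_iff_subgroup_fg _).1 (Group.fg_range ψ)
  let R : AddSubgroup ℝ := Subgroup.toAddSubgroup' ψ.range
  have hR : R.FG := (AddSubgroup.fg_iff_mul_fg R).2 hfg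
  have : Module.Finite ℤ R := by
    rw [Module.Finite.iff_addGroup_fg]
    exact (AddGroup.fg_iff_addSubgroup_fg R).2 hR
  obtain ⟨g, hg⟩ : ∃ g, ψ g ≠ 1 := by
    by_contra! h
    exact hψ (MonoidHom.ext h)
  have hnt : Nontrivial R := ⟨⟨⟨(ψ g).toAdd, g, rfl⟩, 0, fun h => hg (congrArg Subtype.val h)⟩⟩
  -- The image is a finitely generated torsion-free abelian group, hence free; a coordinate with
  -- respect to a basis gives the surjection.
  let b := Module.Free.chooseBasis ℤ R
  obtain ⟨i⟩ := b.index_nonempty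
  let r : G →* Multiplicative R :=
    { toFun := fun g => Multiplicative.ofAdd ⟨(ψ g).toAdd, g, rfl⟩
      map_one' := by apply Subtype.ext; exact congrArg Multiplicative.toAdd (map_one ψ)
      map_mul' := fun x y => by apply Subtype.ext; exact congrArg Multiplicative.toAdd (map_mul ψ x y) }
  refine ⟨(AddMonoidHom.toMultiplicative (b.coord i).toAddMonoidHom).comp r, fun k => ?_⟩
  obtain ⟨g, hg⟩ := (k.toAdd • b i).2
  refine ⟨g, ?_⟩
  have e : (r g).toAdd = k.toAdd • b i := Subtype.ext hg
  change Multiplicative.ofAdd (b.coord i (r g).toAdd) = k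
  rw [e]
  simp

/-- A finitely generated group with a nontrivial homomorphism to the group of maps
`x ↦ x + ℓ(x) u` with `1 + ℓ(u) > 0` surjects onto `ℤ`. -/
theorem exists_surjective_int_of_shear {ι G : Type*} [Group G] (hG : Group.FG G)
    (ℓ : (ι → ℝ) →ₗ[ℝ] ℝ) (u : G → ι → ℝ) (hpos : ∀ g, 0 < 1 + ℓ (u g))
    (hmul : ∀ g h, u (g * h) = u h + (1 + ℓ (u h)) • u g) (hne : ∃ g, u g ≠ 0) :
    ∃ φ : G →* Multiplicative ℤ, Function.Surjective φ := by
  have hδ : ∀ g h, 1 + ℓ (u (g * h)) = (1 + ℓ (u g)) * (1 + ℓ (u h)) := by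
    intro g h
    rw [hmul, map_add, map_smul, smul_eq_mul]
    ring
  by_cases hc : ∃ g, ℓ (u g) ≠ 0
  · obtain ⟨g, hg⟩ := hc
    let ψ : G →* Multiplicative ℝ := MonoidHom.mk'
      (fun g => Multiplicative.ofAdd (Real.log (1 + ℓ (u g)))) (fun a b => by
        rw [hδ, Real.log_mul (hpos a).ne' (hpos b).ne', ofAdd_add])
    refine exists_surjective_int_of_real hG ψ fun h => hg ?_
    have h2 : Real.log (1 + ℓ (u g)) = 0 := DFunLike.congr_fun h g
    have := Real.eq_one_of_pos_of_log_eq_zero (hpos g) h2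
    linarith
  -- All factors `1 + ℓ (u g)` are now `1`, so `hmul` makes each coordinate of `u` a homomorphism.
  · push Not at hc
    obtain ⟨g, hg⟩ := hne
    obtain ⟨i, hi⟩ := Function.ne_iff.1 hg
    let ψ : G →* Multiplicative ℝ := MonoidHom.mk'
      (fun g => Multiplicative.ofAdd (u g i)) (fun a b => by
        rw [hmul, hc]
        simp [mul_comm])
    exact exists_surjective_int_of_real hG ψ fun h => hi (DFunLike.congr_fun h g)

/-- Local indicability of `G` can be checked on the images of finitely generated subgroups under
an injective homomorphism. -/
theorem isLocallyIndicable_of_injective {G Γ : Type*} [Group G] [Group Γ] (j : G →* Γ)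
    (hj : Function.Injective j)
    (h : ∀ H : Subgroup Γ, H ≤ j.range → H.FG → H ≠ ⊥ →
      ∃ φ : H →* Multiplicative ℤ, Function.Surjective φ) : IsLocallyIndicable G := by
  intro H hH hne
  have hfg : (H.map j).FG := by
    classical
    obtain ⟨S, rfl⟩ := hH
    exact ⟨S.image j, by rw [Finset.coe_image, MonoidHom.map_closure]⟩
  obtain ⟨φ, hφ⟩ := h (H.map j) (Subgroup.map_le_range j H) hfg
    (fun h => hne ((Subgroup.map_eq_bot_iff_of_injective H hj).1 h))
  let e := H.equivMapOfInjective j hj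
  exact ⟨φ.comp e.toMonoidHom, hφ.comp e.surjective⟩

/-! ### Walls of PL maps and shears -/

namespace PLTop

/-- Near each point at which the map `f` is piecewise linear there are finitely many walls such
that, at a point `p` lying on no wall other than `l = 0`, the map `f` is affine on the side
`0 ≤ l` of this wall. -/
theorem IsPLAt.exists_walls {m n : ℕ} {X : Set (Fin m → ℝ)} {Y : Set (Fin n → ℝ)} {f : X → Y}
    {x : X} (hf : IsPLAt f x) :
    ∃ L : Set ((Fin m → ℝ) →ᵃ[ℝ] ℝ), L.Finite ∧ ∀ᶠ p : X in 𝓝 x,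
      ∀ l : (Fin m → ℝ) →ᵃ[ℝ] ℝ, (∀ a ∈ L, a p = 0 → ∃ r : ℝ, a = r • l) →
        (∃ᶠ y : X in 𝓝 p, 0 < l y) →
        ∃ A : (Fin m → ℝ) →ᵃ[ℝ] (Fin n → ℝ), ∀ᶠ y : X in 𝓝 p, 0 ≤ l y → (f y : Fin n → ℝ) = A y := by
  obtain ⟨F, h1, h2, h3, h4⟩ := hf
  choose! A hA using h3
  choose! S hS hPS using h2
  refine ⟨⋃ P ∈ F, S P, h1.biUnion hS, ?_⟩
  have hA' := (h1.eventually_all).2 hA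
  filter_upwards [eventually_eventually_nhds.2 hA', eventually_eventually_nhds.2 h4]
    with p hp1 hp2 l hl hfreq
  have hsign : ∀ᶠ y : X in 𝓝 p, ∀ a ∈ ⋃ P ∈ F, S P, a p ≠ 0 → 0 < a y * a p := by
    refine ((h1.biUnion hS).eventually_all).2 fun a _ => ?_
    by_cases hap : a p = 0
    · simp [hap]
    · have hc : Continuous fun y : X => a y * a p :=
        ((a.continuous_of_finiteDimensional).comp continuous_subtype_val).mul continuous_const
      have : 0 < a p * a p := mul_self_pos.2 hap
      filter_upwards [hc.continuousAt.eventually (lt_mem_nhds this)] with y hy _ using hy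
  -- A piece `P` containing one such `y₀` contains the whole side `0 ≤ l` near `p`: inequalities of
  -- `P` not tight at `p` persist nearby, and tight ones are nonnegative multiples of `l`.
  obtain ⟨y₀, hy₀, ⟨P, hP, hyP⟩, hys⟩ := (hfreq.and_eventually (hp2.and hsign)).exists
  refine ⟨A P, ?_⟩
  filter_upwards [hp1, hsign] with y hy hy' hly
  refine hy P hP ?_
  rw [hPS P hP] at hyP ⊢
  intro a ha
  have ha' : a ∈ ⋃ P ∈ F, S P := mem_biUnion hP ha
  have h0 : 0 ≤ a y₀ := hyP a ha
  by_cases hap : a p = 0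
  · obtain ⟨r, rfl⟩ := hl a ha' hap
    have hr : 0 ≤ r := by
      by_contra! hr
      exact absurd (mul_neg_of_neg_of_pos hr hy₀) (not_lt.2 h0)
    exact mul_nonneg hr hly
  · have e1 := hys a ha' hap
    have e2 := hy' a ha' hap
    have hpos : 0 < a p := by
      by_contra! h
      exact absurd (mul_nonpos_of_nonneg_of_nonpos h0 h) (not_le.2 e1)
    exact (pos_of_mul_pos_left e2 hpos.le).le

/-- A nonempty open set is not contained in the union of finitely many hyperplanes. -/
theorem exists_forall_ne_zero {n : ℕ} {L : Set ((Fin n → ℝ) →ᵃ[ℝ] ℝ)} (hL : L.Finite)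
    (h0 : ∀ a ∈ L, a ≠ 0) {U : Set (Fin n → ℝ)} (hU : IsOpen U) (hne : U.Nonempty) :
    ∃ x ∈ U, ∀ a ∈ L, a x ≠ 0 := by
  induction L, hL using Set.Finite.induction_on generalizing U with
  | empty => exact ⟨_, hne.some_mem, by simp⟩
  | @insert a L ha hL ih =>
    have hac : Continuous a := a.continuous_of_finiteDimensional
    obtain ⟨x, hxU, hx⟩ : ∃ x ∈ U, a x ≠ 0 := by
      obtain ⟨x, hx⟩ := hne
      by_contra! hcon
      refine h0 a (mem_insert _ _) (AffineMap.ext fun z => ?_)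
      have hc : Continuous fun t : ℝ => AffineMap.lineMap x z t := AffineMap.lineMap_continuous
      have hev : ∀ᶠ t in 𝓝 (0 : ℝ), AffineMap.lineMap x z t ∈ U :=
        hc.continuousAt.eventually (by simpa using hU.mem_nhds hx)
      obtain ⟨t, ht, ht0⟩ := ((hev.filter_mono nhdsWithin_le_nhds).and
        (self_mem_nhdsWithin : Ioi (0 : ℝ) ∈ 𝓝[>] (0 : ℝ))).exists
      have ht0 : 0 < t := ht0
      have := hcon _ ht
      rw [AffineMap.apply_lineMap, hcon x hx, AffineMap.lineMap_apply] at this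
      simpa [ht0.ne'] using this
    obtain ⟨y, ⟨hyU, hya⟩, hy⟩ := ih (fun b hb => h0 b (mem_insert_of_mem _ hb))
      (hU.inter (isOpen_ne.preimage hac)) ⟨x, hxU, hx⟩
    refine ⟨y, hyU, ?_⟩
    rintro b (rfl | hb)
    · exact hya
    · exact hy b hb

/-- The interior of the half-space. -/
def openHalfSpace (n : ℕ) : Set (Fin n → ℝ) := {x | ∀ i : Fin n, (i : ℕ) = 0 → 0 < x i}

theorem openHalfSpace_subset (n : ℕ) : openHalfSpace n ⊆ halfSpace n :=
  fun _ hx i hi => (hx i hi).le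

theorem isOpen_openHalfSpace (n : ℕ) : IsOpen (openHalfSpace n) := by
  simp only [openHalfSpace, ofPred_forall]
  exact isOpen_iInter_of_finite fun i => isOpen_iInter_of_finite fun _ =>
    isOpen_lt continuous_const (continuous_apply i)

theorem convex_openHalfSpace (n : ℕ) : Convex ℝ (openHalfSpace n) := by
  intro x hx y hy a b ha hb hab i hi
  have h1 := hx i hi
  have h2 := hy i hi
  simp only [Pi.add_apply, Pi.smul_apply, smul_eq_mul]
  rcases ha.eq_or_lt with rfl | ha
  · have : b = 1 := by linarith
    subst this
    linarith
  · have := mul_pos ha h1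
    have := mul_nonneg hb h2.le
    linarith

/-- Open subsets of the half-space contain nonempty open sets of `ℝⁿ`. -/
theorem exists_isOpen_subset {n : ℕ} {V : Set (halfSpace n)} (hV : IsOpen V) (hne : V.Nonempty) :
    ∃ U : Set (Fin n → ℝ), IsOpen U ∧ U.Nonempty ∧ U ⊆ openHalfSpace n ∧
      ∀ (x : Fin n → ℝ) (hx : x ∈ halfSpace n), x ∈ U → (⟨x, hx⟩ : halfSpace n) ∈ V := by
  obtain ⟨W, hW, rfl⟩ := isOpen_induced_iff.1 hV
  obtain ⟨x, hx⟩ := hne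
  refine ⟨W ∩ openHalfSpace n, hW.inter (isOpen_openHalfSpace n), ?_, inter_subset_right,
    fun x _ h => h.1⟩
  -- Moving along `(1, …, 1)` enters the open half-space at once.
  have hc : Continuous fun t : ℝ => (x : Fin n → ℝ) + t • (1 : Fin n → ℝ) := by fun_prop
  have hev : ∀ᶠ t in 𝓝 (0 : ℝ), (x : Fin n → ℝ) + t • (1 : Fin n → ℝ) ∈ W :=
    hc.continuousAt.eventually (by simpa using hW.mem_nhds hx)
  obtain ⟨t, ht, ht0⟩ := ((hev.filter_mono nhdsWithin_le_nhds).and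
    (self_mem_nhdsWithin : Ioi (0 : ℝ) ∈ 𝓝[>] (0 : ℝ))).exists
  have ht0 : 0 < t := ht0
  refine ⟨_, ht, fun i hi => ?_⟩
  have := x.2 i hi
  simp only [Pi.add_apply, Pi.smul_apply, Pi.one_apply, smul_eq_mul, mul_one]
  linarith

/-- The set of coordinates of `ℝⁿ` (at most one) defining the half-space. -/
def boundaryCoord (n : ℕ) : Set ((Fin n → ℝ) →ᵃ[ℝ] ℝ) :=
  {a | ∃ i : Fin n, (i : ℕ) = 0 ∧ a = (LinearMap.proj i : (Fin n → ℝ) →ₗ[ℝ] ℝ).toAffineMap}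

theorem finite_boundaryCoord (n : ℕ) : (boundaryCoord n).Finite := by
  refine (finite_range fun i : Fin n =>
    (LinearMap.proj i : (Fin n → ℝ) →ₗ[ℝ] ℝ).toAffineMap).subset ?_
  rintro a ⟨i, -, rfl⟩
  exact ⟨i, rfl⟩

theorem tendsto_add_smul {n : ℕ} (p v : Fin n → ℝ) :
    Tendsto (fun t : ℝ => p + t • v) (𝓝[>] 0) (𝓝 p) := by
  have hc : Continuous fun t : ℝ => p + t • v := by fun_prop
  have := (hc.tendsto 0).mono_left (nhdsWithin_le_nhds (s := Ioi 0))
  simpa using this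

theorem map_add_smul {m n : ℕ} (A : (Fin m → ℝ) →ᵃ[ℝ] (Fin n → ℝ)) (p v : Fin m → ℝ) (t : ℝ) :
    A (p + t • v) = A p + t • A.linear v := by
  rw [add_comm, ← vadd_eq_add, A.map_vadd, map_smul, vadd_eq_add, add_comm]

theorem map_add_smul_real {m : ℕ} (a : (Fin m → ℝ) →ᵃ[ℝ] ℝ) (p v : Fin m → ℝ) (t : ℝ) :
    a (p + t • v) = a p + t * a.linear v := by
  rw [add_comm, ← vadd_eq_add, a.map_vadd, map_smul, vadd_eq_add, add_comm, smul_eq_mul]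

/-- A point of the half-space on the wall `l = 0`, lying in the boundary only if the boundary is
this wall, can be moved along the wall. -/
theorem eventually_mem_halfSpace {n : ℕ} {p : Fin n → ℝ} (hp : p ∈ halfSpace n)
    {l : (Fin n → ℝ) →ᵃ[ℝ] ℝ} (hb : ∀ a ∈ boundaryCoord n, a p = 0 → ∃ r : ℝ, a = r • l)
    {v : Fin n → ℝ} (hv : l.linear v = 0) : ∀ᶠ t in 𝓝[>] (0 : ℝ), p + t • v ∈ halfSpace n := by
  have : ∀ᶠ t in 𝓝[>] (0 : ℝ), ∀ i : Fin n, (i : ℕ) = 0 → 0 ≤ (p + t • v) i := by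
    refine eventually_all.2 fun i => ?_
    by_cases hi : (i : ℕ) = 0
    · rcases (hp i hi).eq_or_lt with h | h
      · obtain ⟨r, hr⟩ := hb _ ⟨i, hi, rfl⟩ h.symm
        have hlin : v i = r * l.linear v :=
          DFunLike.congr_fun (congrArg AffineMap.linear hr) v
        refine Eventually.of_forall fun t _ => ?_
        simp [hlin, hv, ← h]
      · have hc := (continuous_apply i).continuousAt.tendsto.comp (tendsto_add_smul p v)
        filter_upwards [hc.eventually (lt_mem_nhds h)] with t ht _ using ht.le
    · exact Eventually.of_forall fun t h => absurd h hi
  exact this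

/-- A map which is affine on one side of a wall and fixes the wall is a shear. -/
theorem exists_shear {n : ℕ} {p : halfSpace n} {l : (Fin n → ℝ) →ᵃ[ℝ] ℝ} (hlp : l p = 0)
    (hl : l.linear ≠ 0) (hb : ∀ a ∈ boundaryCoord n, a p = 0 → ∃ r : ℝ, a = r • l)
    {f : halfSpace n → halfSpace n} {A : (Fin n → ℝ) →ᵃ[ℝ] (Fin n → ℝ)}
    (hA : ∀ᶠ y : halfSpace n in 𝓝 p, 0 ≤ l y → (f y : Fin n → ℝ) = A y)
    (hf : ∀ᶠ y : halfSpace n in 𝓝 p, l y = 0 → f y = y) :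
    ∃ u : Fin n → ℝ, ∀ᶠ y : halfSpace n in 𝓝 p, 0 ≤ l y →
      (f y : Fin n → ℝ) = y + l y • u := by
  have hAp : A p = p := by
    rw [← hA.self_of_nhds hlp.ge, hf.self_of_nhds hlp]
  -- For small `t > 0` both `p` and `p + t • v` lie on the wall inside the half-space, so `A` fixes
  -- both.
  have hker : ∀ v, l.linear v = 0 → A.linear v = v := by
    intro v hv
    obtain ⟨V, hV, hVm⟩ := mem_nhds_induced _ _ _ |>.1 (hA.and hf)
    obtain ⟨t, ⟨hmem, htV⟩, ht0⟩ := (((eventually_mem_halfSpace p.2 hb hv).and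
      ((tendsto_add_smul (p : Fin n → ℝ) v).eventually hV)).and
      (self_mem_nhdsWithin : Ioi (0 : ℝ) ∈ 𝓝[>] (0 : ℝ))).exists
    have ht0 : 0 < t := ht0
    have hz : l ((p : Fin n → ℝ) + t • v) = 0 := by rw [map_add_smul_real, hlp, hv]; simp
    obtain ⟨h1, h2⟩ := hVm (show (⟨_, hmem⟩ : halfSpace n) ∈ _ from htV)
    have h3 := h1 hz.ge
    rw [h2 hz] at h3
    change (p : Fin n → ℝ) + t • v = A (p + t • v) at h3
    rw [map_add_smul, hAp] at h3
    exact (smul_right_injective _ ht0.ne' (add_left_cancel h3)).symm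
  obtain ⟨w', hw'⟩ : ∃ w, l.linear w ≠ 0 := by
    by_contra! h
    exact hl (LinearMap.ext h)
  obtain ⟨w, hw⟩ : ∃ w, w = (l.linear w')⁻¹ • w' := ⟨_, rfl⟩
  have hw1 : l.linear w = 1 := by rw [hw, map_smul, smul_eq_mul, inv_mul_cancel₀ hw']
  -- `A.linear` is the identity on `ker l.linear`, so it is determined by its value at the
  -- transversal vector `w`, normalised by `l.linear w = 1`.
  refine ⟨A.linear w - w, ?_⟩
  filter_upwards [hA] with y hy hly
  rw [hy hly]
  have e1 : (y : Fin n → ℝ) = p + (1 : ℝ) • ((y : Fin n → ℝ) - p) := by simp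
  have e2 : l.linear ((y : Fin n → ℝ) - p) = l y := by
    conv_rhs => rw [e1, map_add_smul_real, hlp]
    simp
  have e3 := hker ((y : Fin n → ℝ) - p - l y • w) (by
    rw [map_sub, e2, map_smul, hw1]; simp)
  rw [map_sub, map_smul] at e3
  have e4 : A y = p + A.linear ((y : Fin n → ℝ) - p) := by
    conv_lhs => rw [e1, map_add_smul, hAp]
    simp
  rw [e4, sub_eq_iff_eq_add.1 e3, smul_sub]
  abel

end PLTop

/-! ### Groups acting by shears on one side of a wall -/

namespace PLTop

/-- With symmetric generators, facts about germs extend from generators to the whole group using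
products only, with no need to invert a shear. -/
theorem exists_finite_symmetric_closure {Γ : Type*} [Group Γ] {H : Subgroup Γ} (hH : H.FG) :
    ∃ S : Set Γ, S.Finite ∧ (∀ g ∈ S, g⁻¹ ∈ S) ∧ Subgroup.closure S = H := by
  obtain ⟨S, rfl⟩ := hH
  refine ⟨S ∪ (S : Set Γ)⁻¹, S.finite_toSet.union S.finite_toSet.inv, ?_, ?_⟩
  · rintro g (hg | hg)
    · exact Or.inr (by simpa using hg)
    · exact Or.inl hg
  · rw [Subgroup.closure_union, Subgroup.closure_inv, sup_idem]

variable {n : ℕ} {M : Type*} [TopologicalSpace M]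

theorem eventually_mem_source {c : OpenPartialHomeomorph M (halfSpace n)} {h : M ≃ₜ M}
    {p : halfSpace n} (hp : p ∈ c.target) (hh : h (c.symm p) = c.symm p) :
    ∀ᶠ y in 𝓝 p, h (c.symm y) ∈ c.source := by
  have h1 : ContinuousAt (fun y => h (c.symm y)) p :=
    h.continuous.continuousAt.comp (c.continuousAt_symm hp)
  exact h1 (by simpa only [hh] using c.open_source.mem_nhds (c.map_target hp))

theorem tendsto_chart {c : OpenPartialHomeomorph M (halfSpace n)} {h : M ≃ₜ M}
    {p : halfSpace n} (hp : p ∈ c.target) (hh : h (c.symm p) = c.symm p) :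
    Tendsto (fun y => c (h (c.symm y))) (𝓝 p) (𝓝 p) := by
  have h1 : ContinuousAt (fun y => h (c.symm y)) p :=
    h.continuous.continuousAt.comp (c.continuousAt_symm hp)
  have h2 : ContinuousAt (fun y => c (h (c.symm y))) p :=
    ContinuousAt.comp (g := c) (by rw [hh]; exact c.continuousAt (c.map_target hp)) h1
  have := h2.tendsto
  rwa [hh, c.right_inv hp] at this

/-- A finitely generated group of homeomorphisms acting near a common fixed point by shears of a
half-space surjects onto `ℤ`. -/
theorem exists_surjective_int_of_local_shear {H : Subgroup (M ≃ₜ M)} {S : Set (M ≃ₜ M)}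
    (hS : S.Finite) (hinv : ∀ h ∈ S, h⁻¹ ∈ S) (hSH : Subgroup.closure S = H)
    {c : OpenPartialHomeomorph M (halfSpace n)} {p : halfSpace n} (hp : p ∈ c.target)
    (hfix : ∀ h ∈ S, h (c.symm p) = c.symm p) {l : (Fin n → ℝ) →ᵃ[ℝ] ℝ}
    (hfreq : ∃ᶠ y : halfSpace n in 𝓝 p, 0 < l y)
    (hu : ∀ h ∈ S, ∃ u : Fin n → ℝ, 0 < 1 + l.linear u ∧ ∀ᶠ y : halfSpace n in 𝓝 p, 0 ≤ l y →
      (c (h (c.symm y)) : Fin n → ℝ) = y + l y • u)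
    (hne : ∃ h ∈ S, ∃ᶠ y : halfSpace n in 𝓝 p, 0 ≤ l y ∧ c (h (c.symm y)) ≠ y) :
    ∃ φ : H →* Multiplicative ℤ, Function.Surjective φ := by
  have hline : ∀ (y u : Fin n → ℝ), l (y + l y • u) = l y * (1 + l.linear u) := by
    intro y u
    rw [map_add_smul_real]
    ring
  have hcomp : ∀ (g h : M ≃ₜ M) (u v : Fin n → ℝ), h (c.symm p) = c.symm p →
      0 < 1 + l.linear u →
      (∀ᶠ y : halfSpace n in 𝓝 p, 0 ≤ l y → (c (h (c.symm y)) : Fin n → ℝ) = y + l y • u) →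
      (∀ᶠ y : halfSpace n in 𝓝 p, 0 ≤ l y → (c (g (c.symm y)) : Fin n → ℝ) = y + l y • v) →
      ∀ᶠ y : halfSpace n in 𝓝 p, 0 ≤ l y →
        (c (g (h (c.symm y))) : Fin n → ℝ) = y + l y • (u + (1 + l.linear u) • v) := by
    intro g h u v hh hpos h1 h2
    filter_upwards [h1, (tendsto_chart hp hh).eventually h2, eventually_mem_source hp hh]
      with y hy1 hy2 hy3 hly
    have e1 := hy1 hly
    rw [c.left_inv hy3, e1, hline] at hy2
    rw [hy2 (mul_nonneg hly hpos.le), smul_add, smul_smul, add_assoc]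
  have hall : ∀ h ∈ H, h (c.symm p) = c.symm p ∧ ∃ u : Fin n → ℝ, 0 < 1 + l.linear u ∧
      ∀ᶠ y : halfSpace n in 𝓝 p, 0 ≤ l y → (c (h (c.symm y)) : Fin n → ℝ) = y + l y • u := by
    intro h hh
    rw [← hSH] at hh
    induction hh using Subgroup.closure_induction'' with
    | mem h hh => exact ⟨hfix h hh, hu h hh⟩
    | inv_mem h hh => exact ⟨hfix _ (hinv h hh), hu _ (hinv h hh)⟩
    | one =>
      refine ⟨rfl, 0, by simp, ?_⟩
      filter_upwards [c.open_target.mem_nhds hp] with y hy _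
      change (c (c.symm y) : Fin n → ℝ) = _
      rw [c.right_inv hy]
      simp
    | mul g h _ _ ihg ihh =>
      obtain ⟨hg, v, hv, hv'⟩ := ihg
      obtain ⟨hh, u, hu, hu'⟩ := ihh
      refine ⟨by change g (h (c.symm p)) = _; rw [hh, hg], _, ?_, hcomp g h u v hh hu hu' hv'⟩
      have : 1 + l.linear (u + (1 + l.linear u) • v) = (1 + l.linear u) * (1 + l.linear v) := by
        rw [map_add, map_smul, smul_eq_mul]; ring
      rw [this]
      exact mul_pos hu hv
  choose u hpos hu' using fun h : H => (hall h h.2).2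
  -- Points with `0 < l` accumulate at `p`, so the germ determines the vector `u`; this turns
  -- composition of germs into the identity for `u (g * h)`.
  have huniq : ∀ v w : Fin n → ℝ, (∀ᶠ y : halfSpace n in 𝓝 p, 0 ≤ l y →
      (y : Fin n → ℝ) + l y • v = y + l y • w) → v = w := by
    intro v w h
    obtain ⟨y, hy, hy'⟩ := (hfreq.and_eventually h).exists
    exact smul_right_injective _ hy.ne' (add_left_cancel (hy' hy.le))
  refine exists_surjective_int_of_shear ((Group.fg_iff_subgroup_fg H).2 ?_) l.linear u hpos ?_ ?_
  · rw [← hSH]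
    exact ⟨hS.toFinset, by simp⟩
  · intro g h
    refine huniq _ _ ?_
    filter_upwards [hu' (g * h), hcomp g h _ _ (hall h h.2).1 (hpos h) (hu' h) (hu' g)]
      with y h1 h2 hly
    rw [← h1 hly, ← h2 hly]
    rfl
  · obtain ⟨h, hh, hne⟩ := hne
    have hhH : h ∈ H := hSH ▸ Subgroup.subset_closure hh
    refine ⟨⟨h, hhH⟩, fun h0 => ?_⟩
    obtain ⟨y, ⟨hly, hy⟩, hy'⟩ := (hne.and_eventually (hu' ⟨h, hhH⟩)).exists
    refine hy (Subtype.ext ?_)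
    have := hy' hly
    rw [h0] at this
    simpa using this

/-- A finitely generated group of homeomorphisms which fixes a wall, is affine on one side of it,
and preserves this side without being trivial there, surjects onto `ℤ`. -/
theorem exists_surjective_int_of_wall {H : Subgroup (M ≃ₜ M)} {S : Set (M ≃ₜ M)}
    (hS : S.Finite) (hinv : ∀ h ∈ S, h⁻¹ ∈ S) (hSH : Subgroup.closure S = H)
    {c : OpenPartialHomeomorph M (halfSpace n)} {p : halfSpace n} (hp : p ∈ c.target)
    {l : (Fin n → ℝ) →ᵃ[ℝ] ℝ} (hlp : l p = 0) (hl : l.linear ≠ 0)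
    (hb : ∀ a ∈ boundaryCoord n, a p = 0 → ∃ r : ℝ, a = r • l)
    (hfix : ∀ h ∈ S, ∀ᶠ y : halfSpace n in 𝓝 p, l y = 0 → h (c.symm y) = c.symm y)
    (hA : (∃ᶠ y : halfSpace n in 𝓝 p, 0 < l y) → ∀ h ∈ S,
      ∃ A : (Fin n → ℝ) →ᵃ[ℝ] (Fin n → ℝ), ∀ᶠ y : halfSpace n in 𝓝 p, 0 ≤ l y →
        (c (h (c.symm y)) : Fin n → ℝ) = A y)
    (hpos : (∃ᶠ y : halfSpace n in 𝓝 p, 0 < l y) → ∀ h ∈ S, ∀ u : Fin n → ℝ,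
      (∀ᶠ y : halfSpace n in 𝓝 p, 0 ≤ l y → (c (h (c.symm y)) : Fin n → ℝ) = y + l y • u) →
      0 < 1 + l.linear u)
    (hne : ∃ h ∈ S, ∃ᶠ y : halfSpace n in 𝓝 p, 0 ≤ l y ∧ h (c.symm y) ≠ c.symm y) :
    ∃ φ : H →* Multiplicative ℤ, Function.Surjective φ := by
  obtain ⟨h₀, hh₀, hne⟩ := hne
  have hfix' : ∀ h ∈ S, h (c.symm p) = c.symm p := fun h hh => (hfix h hh).self_of_nhds hlp
  -- At a boundary point the half-space may lie entirely in `l ≤ 0`. A moved point with `0 ≤ l`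
  -- rules this out, since wall points are fixed.
  have hfreq : ∃ᶠ y : halfSpace n in 𝓝 p, 0 < l y := by
    refine (hne.and_eventually (hfix h₀ hh₀)).mono ?_
    rintro y ⟨⟨h1, h2⟩, h3⟩
    exact h1.lt_of_ne fun h => h2 (h3 h.symm)
  refine exists_surjective_int_of_local_shear hS hinv hSH hp hfix' hfreq (fun h hh => ?_)
    ⟨h₀, hh₀, ?_⟩
  · obtain ⟨A, hA⟩ := hA hfreq h hh
    obtain ⟨u, hu⟩ := exists_shear (f := fun y => c (h (c.symm y))) hlp hl hb hA (by
      filter_upwards [hfix h hh, c.open_target.mem_nhds hp] with y h1 h2 h3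
      rw [h1 h3, c.right_inv h2])
    exact ⟨u, hpos hfreq h hh u hu, hu⟩
  · refine (hne.and_eventually (eventually_mem_source hp (hfix' h₀ hh₀))).mono ?_
    rintro y ⟨⟨h1, h2⟩, h3⟩
    refine ⟨h1, fun h => h2 ?_⟩
    rw [← c.left_inv h3, h]

variable [ChartedSpace (halfSpace n) M] [HasGroupoid M (plGroupoid n)]

/-- The walls of finitely many PL homeomorphisms near a common fixed point. -/
theorem exists_common_walls {S : Set (M ≃ₜ M)} (hS : S.Finite) (hPL : ∀ h ∈ S, h ∈ PLHomeo n M)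
    {c : OpenPartialHomeomorph M (halfSpace n)} (hc : c ∈ atlas (halfSpace n) M) {q : M}
    (hq : q ∈ c.source) (hfix : ∀ h ∈ S, h q = q) :
    ∃ L : Set ((Fin n → ℝ) →ᵃ[ℝ] ℝ), L.Finite ∧ boundaryCoord n ⊆ L ∧
      ∀ᶠ p : halfSpace n in 𝓝 (c q), ∀ l : (Fin n → ℝ) →ᵃ[ℝ] ℝ,
        (∀ a ∈ L, a p = 0 → ∃ r : ℝ, a = r • l) → (∃ᶠ y : halfSpace n in 𝓝 p, 0 < l y) →
        ∀ h ∈ S, ∃ A : (Fin n → ℝ) →ᵃ[ℝ] (Fin n → ℝ), ∀ᶠ y : halfSpace n in 𝓝 p, 0 ≤ l y →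
          (c (h (c.symm y)) : Fin n → ℝ) = A y := by
  have h1 := fun h hh => (isPLAt_of_mem (hPL h hh) hc hc (c.map_source hq)
    (by rwa [c.left_inv hq, hfix h hh])).exists_walls
  choose! L hL hL' using h1
  refine ⟨(⋃ h ∈ S, L h) ∪ boundaryCoord n, (hS.biUnion hL).union (finite_boundaryCoord n),
    subset_union_right, ?_⟩
  filter_upwards [(hS.eventually_all).2 hL'] with p hp l hl hfr h hh
  exact hp h hh l (fun a ha => hl a (Or.inl (mem_biUnion hh ha))) hfr

end PLTop

/-! ### Groups fixing a nonempty open set -/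

namespace PLTop

theorem frequently_subtype {α : Type*} [TopologicalSpace α] {X : Set α} {p : X} {Q : X → Prop}
    (h : ∃ᶠ z in 𝓝 (p : α), ∃ hz : z ∈ X, Q ⟨z, hz⟩) : ∃ᶠ z in 𝓝 p, Q z := by
  rw [frequently_iff] at h ⊢
  intro U hU
  obtain ⟨V, hV, hVU⟩ := (mem_nhds_induced _ _ _).1 hU
  obtain ⟨z, hzV, hz, hQ⟩ := h hV
  exact ⟨⟨z, hz⟩, hVU hzV, hQ⟩

/-- Given finitely many hyperplanes and two nonempty open sets, some segment from the first set
to the second does not meet the intersection of two distinct hyperplanes. -/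
theorem exists_generic_segment {n : ℕ} {L : Set ((Fin n → ℝ) →ᵃ[ℝ] ℝ)} (hL : L.Finite)
    {U V : Set (Fin n → ℝ)} (hU : IsOpen U) (hV : IsOpen V) (hUn : U.Nonempty)
    (hVn : V.Nonempty) :
    ∃ x ∈ U, ∃ y ∈ V, ∀ p ∈ segment ℝ x y, x ≠ y →
      ∃ l : (Fin n → ℝ) →ᵃ[ℝ] ℝ, l p = 0 ∧ l.linear ≠ 0 ∧
        ∀ a ∈ L, a p = 0 → ∃ r : ℝ, a = r • l := by
  obtain ⟨y, hy, hyL⟩ := exists_forall_ne_zero (L := {a ∈ L | a ≠ 0})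
    (hL.subset (sep_subset _ _)) (fun a ha => ha.2) hV hVn
  -- The functional `b y • a - a y • b` vanishes at `y` and wherever `a` and `b` both vanish. If
  -- these meet the segment at a point other than `y`, it also vanishes at `x`, which the choice of
  -- `x` allows only if it is zero, i.e. `a` and `b` are dependent.
  obtain ⟨x, hx, hxL⟩ := exists_forall_ne_zero
    (L := {d ∈ image2 (fun a b : (Fin n → ℝ) →ᵃ[ℝ] ℝ => b y • a - a y • b) L L | d ≠ 0})
    ((hL.image2 _ hL).subset (sep_subset _ _)) (fun a ha => ha.2) hU hUn
  refine ⟨x, hx, y, hy, fun p hp hxy => ?_⟩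
  by_cases hex : ∃ a ∈ L, a ≠ 0 ∧ a p = 0
  · obtain ⟨l, hlL, hl0, hlp⟩ := hex
    refine ⟨l, hlp, fun h => hl0 (AffineMap.ext_linear (p := p) (by simpa using h) (by simpa using hlp)), ?_⟩
    intro a ha hap
    have hly : l y ≠ 0 := hyL l ⟨hlL, hl0⟩
    obtain ⟨s, t, hs, ht, hst, rfl⟩ := hp
    have key : ∀ b : (Fin n → ℝ) →ᵃ[ℝ] ℝ, b (s • x + t • y) = s * b x + t * b y := by
      intro b
      have := Convex.combo_affine_apply (f := b) (x := x) (y := y) hst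
      simpa using this
    have hzero : l y • a - a y • l = 0 := by
      by_contra hd
      have h1 := hxL _ ⟨⟨a, ha, l, hlL, rfl⟩, hd⟩
      rw [key] at hlp hap
      have h2 : (l y • a - a y • l) x = l y * a x - a y * l x := by simp
      rw [h2] at h1
      have hs0 : s ≠ 0 := by
        rintro rfl
        have : t = 1 := by linarith
        subst this
        exact hly (by linarith)
      refine h1 (mul_left_cancel₀ hs0 ?_)
      linear_combination l y * hap - a y * hlp
    refine ⟨a y / l y, ?_⟩
    rw [sub_eq_zero] at hzero
    rw [div_eq_inv_mul, mul_smul, ← hzero, smul_smul, inv_mul_cancel₀ hly, one_smul]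
  -- No nonzero wall passes through `p`, so any nonconstant `l` vanishing at `p` works; `x ≠ y`
  -- supplies a coordinate.
  · push Not at hex
    obtain ⟨i, -⟩ := Function.ne_iff.1 hxy
    refine ⟨(LinearMap.proj i : (Fin n → ℝ) →ₗ[ℝ] ℝ).toAffineMap -
      AffineMap.const ℝ _ (p i), by simp, ?_, ?_⟩
    · intro h
      have := DFunLike.congr_fun h (Pi.single i 1)
      simp at this
    · intro a ha hap
      by_contra hcon
      exact hex a ha (fun h => hcon ⟨0, by rw [h, zero_smul]⟩) hap

variable {n : ℕ} {M : Type*} [TopologicalSpace M]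

/-- Otherwise `G` and the complement of its closure would disconnect the segment. -/
theorem exists_frontier_point {G : Set (Fin n → ℝ)} (hG : IsOpen G) {x y : Fin n → ℝ}
    (hx : x ∈ G) (hy : y ∉ G) : ∃ p ∈ segment ℝ x y, p ∈ closure G ∧ p ∉ G := by
  by_contra! hcon
  refine hy ((convex_segment x y).isPreconnected.subset_left_of_subset_union hG
    isClosed_closure.isOpen_compl
    (disjoint_compl_right_iff_subset.2 subset_closure) (fun p hp => ?_)
    ⟨x, left_mem_segment ℝ x y, hx⟩ (right_mem_segment ℝ x y))
  by_cases h : p ∈ closure G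
  · exact Or.inl (hcon p hp h)
  · exact Or.inr h

/-- Finitely many neighbourhoods on which single generators are trivial intersect in a neighbourhood
fixed by all of `S`. -/
theorem not_forall_eventually_fixed {S : Set (M ≃ₜ M)} (hS : S.Finite)
    {c : OpenPartialHomeomorph M (halfSpace n)} {p : halfSpace n} (hp : p ∈ c.target)
    (hpS : c.symm p ∉ interior {x | ∀ h ∈ S, h x = x}) :
    ∃ h ∈ S, ∃ᶠ y in 𝓝 p, h (c.symm y) ≠ c.symm y := by
  by_contra! hcon
  refine hpS ?_
  have h1 : ∀ᶠ y in 𝓝 p, ∀ h ∈ S, h (c.symm y) = c.symm y :=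
    (hS.eventually_all).2 fun h hh => by simpa using hcon h hh
  rw [mem_interior_iff_mem_nhds]
  have h2 : Tendsto c (𝓝 (c.symm p)) (𝓝 p) := by
    have := (c.continuousAt (c.map_target hp)).tendsto
    rwa [c.right_inv hp] at this
  filter_upwards [h2.eventually h1, c.open_source.mem_nhds (c.map_target hp)] with z hz hzs
  rw [c.left_inv hzs] at hz
  exact hz

/-- If one side of a wall is fixed by an injective map, the other side is preserved. -/
theorem one_add_pos_of_fixed_side {c : OpenPartialHomeomorph M (halfSpace n)} {p : halfSpace n}
    (hp : p ∈ c.target) {l : (Fin n → ℝ) →ᵃ[ℝ] ℝ} (hlp : l p = 0) {h : M ≃ₜ M}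
    (hfix : ∀ᶠ y : halfSpace n in 𝓝 p, l y ≤ 0 → h (c.symm y) = c.symm y)
    (hfreq : ∃ᶠ y : halfSpace n in 𝓝 p, 0 < l y) {u : Fin n → ℝ}
    (hu : ∀ᶠ y : halfSpace n in 𝓝 p, 0 ≤ l y →
      (c (h (c.symm y)) : Fin n → ℝ) = y + l y • u) : 0 < 1 + l.linear u := by
  -- Otherwise a point with `0 < l` would be mapped into the fixed side; its image would then be
  -- fixed, and injectivity would make the point equal to its image.
  by_contra! hneg
  have hhp := hfix.self_of_nhds hlp.le
  obtain ⟨y, hly, h1, h2, h3, h4⟩ := (hfreq.and_eventually (hu.and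
    (((tendsto_chart hp hhp).eventually hfix).and ((eventually_mem_source hp hhp).and
      (c.open_target.mem_nhds hp))))).exists
  have e1 := h1 hly.le
  have e2 : l (c (h (c.symm y)) : Fin n → ℝ) ≤ 0 := by
    rw [e1, map_add_smul_real]
    have : l y + l y * l.linear u = l y * (1 + l.linear u) := by ring
    rw [this]
    exact mul_nonpos_of_nonneg_of_nonpos hly.le hneg
  have e3 := h2 e2
  rw [c.left_inv h3] at e3
  have e4 := h.injective e3
  rw [e4, c.right_inv h4] at e2
  exact absurd hly (not_lt.2 e2)

variable [ChartedSpace (halfSpace n) M] [HasGroupoid M (plGroupoid n)]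

/-- A nontrivial finitely generated group of PL homeomorphisms of a connected manifold which fixes
a nonempty open set surjects onto `ℤ`. -/
theorem exists_surjective_int_of_interior [T2Space M] [PreconnectedSpace M]
    {H : Subgroup (M ≃ₜ M)} {S : Set (M ≃ₜ M)}
    (hS : S.Finite) (hinv : ∀ h ∈ S, h⁻¹ ∈ S) (hSH : Subgroup.closure S = H)
    (hPL : ∀ h ∈ S, h ∈ PLHomeo n M) (hH : H ≠ ⊥)
    (hint : (interior {x | ∀ h ∈ S, h x = x}).Nonempty) :
    ∃ φ : H →* Multiplicative ℤ, Function.Surjective φ := by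
  obtain ⟨F, hF⟩ : ∃ F, F = {x | ∀ h ∈ S, h x = x} := ⟨_, rfl⟩
  rw [← hF] at hint
  have hFc : IsClosed F := by
    rw [hF]
    simp only [ofPred_forall]
    exact isClosed_biInter fun h _ => isClosed_eq h.continuous continuous_id
  have hFne : interior F ≠ univ := by
    intro h
    refine hH ?_
    rw [← hSH, Subgroup.closure_eq_bot_iff]
    intro g hg
    refine Homeomorph.ext fun x => ?_
    have hx : x ∈ F := interior_subset (h ▸ mem_univ x)
    rw [hF] at hx
    exact hx g hg
  -- Connectedness of `M` enters here.
  obtain ⟨q, hqc, hqi⟩ := nonempty_frontier_iff.2 ⟨hint, hFne⟩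
  rw [interior_interior] at hqi
  have hqF : q ∈ F := closure_minimal interior_subset hFc hqc
  have hqfix : ∀ h ∈ S, h q = q := by rw [hF] at hqF; exact hqF
  obtain ⟨c, hc, hqs⟩ : ∃ c ∈ atlas (halfSpace n) M, q ∈ c.source :=
    ⟨chartAt _ q, chart_mem_atlas _ _, mem_chart_source _ _⟩
  obtain ⟨L, hL, hbL, hwall⟩ := exists_common_walls hS hPL hc hqs hqfix
  obtain ⟨r, hr, hball⟩ := Metric.eventually_nhds_iff_ball.1
    (hwall.and (c.open_target.mem_nhds (c.map_source hqs)))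
  have hnear : c.source ∩ c ⁻¹' Metric.ball (c q) r ∈ 𝓝 q :=
    inter_mem (c.open_source.mem_nhds hqs) (c.continuousAt hqs (Metric.ball_mem_nhds _ hr))
  -- the fixed and the moved part of the ball
  obtain ⟨D, hD⟩ : ∃ D, D = Metric.ball (c q) r ∩ (c.target ∩ c.symm ⁻¹' interior F) := ⟨_, rfl⟩
  have hDo : IsOpen D := hD ▸ Metric.isOpen_ball.inter (c.isOpen_inter_preimage_symm isOpen_interior)
  have hDne : D.Nonempty := by
    obtain ⟨z, ⟨hz1, hz2⟩, hz3⟩ := mem_closure_iff_nhds.1 hqc _ hnear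
    exact ⟨c z, hD ▸ ⟨hz2, c.map_source hz1, by rwa [mem_preimage, c.left_inv hz1]⟩⟩
  obtain ⟨D', hD'⟩ : ∃ D, D = Metric.ball (c q) r ∩ (c.target ∩ c.symm ⁻¹' Fᶜ) := ⟨_, rfl⟩
  have hDo' : IsOpen D' :=
    hD' ▸ Metric.isOpen_ball.inter (c.isOpen_inter_preimage_symm hFc.isOpen_compl)
  have hDne' : D'.Nonempty := by
    obtain ⟨z, ⟨hz1, hz2⟩, hz3⟩ : ∃ z ∈ c.source ∩ c ⁻¹' Metric.ball (c q) r, z ∉ F := by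
      by_contra! hcon
      exact hqi (mem_interior_iff_mem_nhds.2 (mem_of_superset hnear hcon))
    exact ⟨c z, hD' ▸ ⟨hz2, c.map_source hz1, by rwa [mem_preimage, c.left_inv hz1]⟩⟩
  obtain ⟨U, hU, hUn, hUo, hUD⟩ := exists_isOpen_subset hDo hDne
  obtain ⟨V, hV, hVn, hVo, hVD⟩ := exists_isOpen_subset hDo' hDne'
  obtain ⟨x, hx, y, hy, hseg⟩ := exists_generic_segment hL hU hV hUn hVn
  -- The segment stays in the open half-space, so the exit from `D` can be studied with the open set
  -- `openHalfSpace n ∩ W` of ℝⁿ.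
  obtain ⟨W, hW, hWD⟩ := isOpen_induced_iff.1 hDo
  have hxW : x ∈ openHalfSpace n ∩ W := by
    refine ⟨hUo hx, ?_⟩
    have := hUD x (openHalfSpace_subset n (hUo hx)) hx
    rw [← hWD] at this
    exact this
  have hyW : y ∉ openHalfSpace n ∩ W := by
    rintro ⟨-, hyW⟩
    have h1 := hVD y (openHalfSpace_subset n (hVo hy)) hy
    have h2 : (⟨y, openHalfSpace_subset n (hVo hy)⟩ : halfSpace n) ∈ D := by
      rw [← hWD]; exact hyW
    rw [hD'] at h1
    rw [hD] at h2
    exact h1.2.2 (interior_subset h2.2.2)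
  obtain ⟨p', hpseg, hpcl, hpW⟩ := exists_frontier_point ((isOpen_openHalfSpace n).inter hW) hxW hyW
  have hpo : p' ∈ openHalfSpace n :=
    (convex_openHalfSpace n).segment_subset (hUo hx) (hVo hy) hpseg
  have hxb : x ∈ Metric.ball (c q : Fin n → ℝ) r := by
    have := hUD x (openHalfSpace_subset n (hUo hx)) hx
    rw [hD] at this
    exact this.1
  have hyb : y ∈ Metric.ball (c q : Fin n → ℝ) r := by
    have := hVD y (openHalfSpace_subset n (hVo hy)) hy
    rw [hD'] at this
    exact this.1
  have hpb : p' ∈ Metric.ball (c q : Fin n → ℝ) r :=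
    (convex_ball _ _).segment_subset hxb hyb hpseg
  obtain ⟨p, rfl⟩ : ∃ p : halfSpace n, p' = p := ⟨⟨p', openHalfSpace_subset n hpo⟩, rfl⟩
  obtain ⟨hpwall, hpt⟩ := hball p hpb
  have hpD : p ∉ D := fun h => hpW ⟨hpo, by rw [← hWD] at h; exact h⟩
  have hpint : c.symm p ∉ interior F := fun h => hpD (hD ▸ ⟨hpb, hpt, h⟩)
  have hfreqD : ∃ᶠ z in 𝓝 p, z ∈ D := by
    refine frequently_subtype ((mem_closure_iff_frequently.1 hpcl).mono fun z hz => ?_)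
    exact ⟨openHalfSpace_subset n hz.1, by rw [← hWD]; exact hz.2⟩
  obtain ⟨l, hlp, hl, hgen⟩ := hseg p hpseg (fun h => hyW (h ▸ hxW))
  have hDfix : ∀ z ∈ D, ∀ h ∈ S, h (c.symm z) = c.symm z := by
    intro z hz h hh
    rw [hD] at hz
    have := interior_subset hz.2.2
    rw [hF] at this
    exact this h hh
  have hfixp : ∀ h ∈ S, h (c.symm p) = c.symm p := by
    have : c.symm p ∈ F := by
      refine hFc.mem_of_frequently_of_tendsto (hfreqD.mono fun z hz => ?_)
        (c.continuousAt_symm hpt).tendsto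
      rw [hD] at hz
      exact interior_subset hz.2.2
    rw [hF] at this
    exact this
  -- the fixed side of the wall
  have main : ∀ l : (Fin n → ℝ) →ᵃ[ℝ] ℝ, l p = 0 → l.linear ≠ 0 →
      (∀ a ∈ L, a p = 0 → ∃ r : ℝ, a = r • l) → (∃ᶠ z : halfSpace n in 𝓝 p, z ∈ D ∧ l z < 0) →
      ∃ φ : H →* Multiplicative ℤ, Function.Surjective φ := by
    intro l hlp hl hgen hfr
    have hside : ∀ h ∈ S, ∀ᶠ y : halfSpace n in 𝓝 p, l y ≤ 0 → h (c.symm y) = c.symm y := by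
      intro h hh
      -- On the side `l ≤ 0` each generator is affine near `p`, and agrees with the identity on open
      -- pieces of `D` close to `p`; hence it is the identity there.
      obtain ⟨A, hA⟩ := hpwall (-l)
        (fun a ha hap => (hgen a ha hap).imp' Neg.neg fun r hr => by rw [hr]; simp)
        (hfr.mono fun z hz => by simpa using hz.2) h hh
      have hAid : A = AffineMap.id ℝ _ := by
        obtain ⟨z, ⟨hzD, hz⟩, hzA⟩ := (hfr.and_eventually (eventually_eventually_nhds.2 hA)).exists
        have hzneg : ∀ᶠ w : halfSpace n in 𝓝 z, l w < 0 :=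
          ((l.continuous_of_finiteDimensional).comp continuous_subtype_val).continuousAt.eventually
            (gt_mem_nhds hz)
        have hzid : ∀ᶠ w : halfSpace n in 𝓝 z, A w = AffineMap.id ℝ (Fin n → ℝ) w := by
          filter_upwards [hzA, hzneg, hDo.mem_nhds hzD] with w h1 h2 h3
          rw [← h1 (by simpa using h2.le), hDfix w h3 h hh]
          rw [hD] at h3
          rw [c.right_inv h3.2.1]
          rfl
        exact AffineMap.ext_linear (linear_eq_of_eventually hzid) hzid.self_of_nhds
      filter_upwards [hA, eventually_mem_source hpt (hfixp h hh)] with y h1 h2 h3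
      have h4 := h1 (by simpa using h3)
      rw [hAid] at h4
      have h5 : c (h (c.symm y)) = y := Subtype.ext h4
      rw [← c.left_inv h2, h5]
    refine exists_surjective_int_of_wall hS hinv hSH hpt hlp hl (fun a ha => hgen a (hbL ha))
      (fun h hh => (hside h hh).mono fun y hy h0 => hy h0.le) (hpwall l hgen)
      (fun hfreq h hh u hu => one_add_pos_of_fixed_side hpt hlp (hside h hh) hfreq hu) ?_
    -- Some generator moves points arbitrarily close to `p`, necessarily on the side not fixed.
    obtain ⟨h, hh, hfr⟩ := not_forall_eventually_fixed hS hpt (hF ▸ hpint)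
    refine ⟨h, hh, (hfr.and_eventually (hside h hh)).mono ?_⟩
    rintro y ⟨h1, h2⟩
    refine ⟨?_, h1⟩
    by_contra! hneg
    exact h1 (h2 hneg.le)
  -- `D` accumulates at `p` and is open, so it has points off the wall arbitrarily close to `p`; one
  -- side receives them frequently, and `l` or `-l` is chosen accordingly.
  have hsplit : ∃ᶠ z : halfSpace n in 𝓝 p, (z ∈ D ∧ l z < 0) ∨ (z ∈ D ∧ (-l) z < 0) := by
    rw [frequently_iff]
    intro N hN
    obtain ⟨N', hN', hNo, hpN⟩ := mem_nhds_iff.1 hN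
    obtain ⟨z, hzN, hzD⟩ := (frequently_iff.1 hfreqD) (hNo.mem_nhds hpN)
    obtain ⟨O, hO, hOn, hOo, hOD⟩ := exists_isOpen_subset (hNo.inter hDo) ⟨z, hzN, hzD⟩
    obtain ⟨w, hw, hlw⟩ := exists_forall_ne_zero (finite_singleton l)
      (by rintro a rfl rfl; exact hl rfl) hO hOn
    have hwl := hlw l rfl
    obtain ⟨h1, h2⟩ := hOD w (openHalfSpace_subset n (hOo hw)) hw
    refine ⟨_, hN' h1, ?_⟩
    rcases lt_or_gt_of_ne hwl with h | h
    · exact Or.inl ⟨h2, h⟩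
    · exact Or.inr ⟨h2, by simpa using h⟩
  rcases frequently_or_distrib.1 hsplit with h | h
  · exact main l hlp hl hgen h
  · exact main (-l) (by simp [hlp]) (by simpa using hl)
      (fun a ha hap => (hgen a ha hap).imp' Neg.neg fun r hr => by rw [hr]; simp) h

end PLTop

/-! ### Groups fixing a hypersurface, and the group `PL₊(M, K)` -/

namespace PLTop

variable {n m : ℕ} {M : Type*} [TopologicalSpace M] [ChartedSpace (halfSpace n) M]

/-- A PL submanifold contains the image of an open set under an injective affine map. -/
theorem IsPLSubmanifold.exists_affine_patch {K : Set M} (hK : IsPLSubmanifold n m K)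
    (hne : K.Nonempty) :
    ∃ c ∈ atlas (halfSpace n) M, ∃ A : (Fin m → ℝ) →ᵃ[ℝ] (Fin n → ℝ), ∃ U : Set (Fin m → ℝ),
      IsOpen U ∧ U.Nonempty ∧ Function.Injective A.linear ∧
        ∀ v ∈ U, ∃ k ∈ K, k ∈ c.source ∧ (c k : Fin n → ℝ) = A v := by
  obtain ⟨x, hx⟩ := hne
  obtain ⟨φ, hxφ, hφ⟩ := hK ⟨x, hx⟩
  obtain ⟨c, hc, hxc⟩ : ∃ c ∈ atlas (halfSpace n) M, x ∈ c.source :=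
    ⟨chartAt _ x, chart_mem_atlas _ _, mem_chart_source _ _⟩
  obtain ⟨y₀, hy₀⟩ : ∃ y, y = φ ⟨x, hx⟩ := ⟨_, rfl⟩
  have hyt : y₀ ∈ φ.target := hy₀ ▸ φ.map_source hxφ
  have hyx : (φ.symm y₀ : M) = x := by rw [hy₀, φ.left_inv hxφ]
  have hgood : ∀ᶠ y in 𝓝 y₀, y ∈ φ.target ∧ (φ.symm y : M) ∈ c.source := by
    have h1 : ContinuousAt (fun y => (φ.symm y : M)) y₀ :=
      continuous_subtype_val.continuousAt.comp (φ.continuousAt_symm hyt)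
    have h2 : ∀ᶠ y in 𝓝 y₀, y ∈ φ.target := φ.open_target.mem_nhds hyt
    exact h2.and (h1 (c.open_source.mem_nhds (show (φ.symm y₀ : M) ∈ c.source from hyx ▸ hxc)))
  -- The parametrisation is affine near points arbitrarily close to `y₀`; there `A` inherits
  -- injectivity from `φ.symm` and `c`.
  obtain ⟨y, ⟨A, hA⟩, hy⟩ := ((hφ y₀ hyt c hc
    (by rw [hyx]; exact hxc)).frequently_hasAffineGerm.and_eventually
      (eventually_eventually_nhds.2 hgood)).exists
  obtain ⟨V, hV, hVo, hyV⟩ := eventually_nhds_iff.1 (hA.and hy)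
  obtain ⟨U, hU, hUn, hUo, hUV⟩ := exists_isOpen_subset hVo ⟨y, hyV⟩
  have hinj : ∀ v ∈ U, ∀ w ∈ U, A v = A w → v = w := by
    intro v hv w hw hvw
    obtain ⟨h1, h2, h3⟩ := hV _ (hUV v (openHalfSpace_subset m (hUo hv)) hv)
    obtain ⟨k1, k2, k3⟩ := hV _ (hUV w (openHalfSpace_subset m (hUo hw)) hw)
    have e1 := c.injOn h3 k3 (Subtype.ext (h1.trans (hvw.trans k1.symm)))
    exact congrArg Subtype.val (φ.symm.injOn h2 k2 (Subtype.ext e1))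
  refine ⟨c, hc, A, U, hU, hUn, ?_, ?_⟩
  · rw [injective_iff_map_eq_zero]
    intro v hv
    obtain ⟨u, hu⟩ := hUn
    obtain ⟨t, ht, ht0⟩ := (((tendsto_add_smul u v).eventually (hU.mem_nhds hu)).and
      (self_mem_nhdsWithin : Ioi (0 : ℝ) ∈ 𝓝[>] (0 : ℝ))).exists
    have ht0 : 0 < t := ht0
    have := hinj _ ht _ hu (by rw [map_add_smul, hv, smul_zero, add_zero])
    simpa [ht0.ne'] using this
  · intro v hv
    obtain ⟨h1, h2, h3⟩ := hV _ (hUV v (openHalfSpace_subset m (hUo hv)) hv)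
    exact ⟨_, (φ.symm _).2, h3, h1⟩

/-- An orientation-preserving shear has positive determinant. -/
theorem PLOrientation.Preserves.one_add_pos {o : PLOrientation n M} {h : M ≃ₜ M}
    (ho : o.Preserves h) {c : OpenPartialHomeomorph M (halfSpace n)}
    (hc : c ∈ atlas (halfSpace n) M) {p : halfSpace n} (hp : p ∈ c.target)
    (hfix : h (c.symm p) = c.symm p) {l : (Fin n → ℝ) →ᵃ[ℝ] ℝ}
    (hfreq : ∃ᶠ y : halfSpace n in 𝓝 p, 0 < l y) {u : Fin n → ℝ}
    (hu : ∀ᶠ y : halfSpace n in 𝓝 p, 0 ≤ l y →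
      (c (h (c.symm y)) : Fin n → ℝ) = y + l y • u) : 0 < 1 + l.linear u := by
  have hps := c.map_target hp
  have hs1 := (c.continuousAt_symm hp).eventually (o.eventually_sign_eq hc continuous_id hps)
  have hs2 := (c.continuousAt_symm hp).eventually
    (o.eventually_sign_eq hc h.continuous (by rw [hfix]; exact hps))
  obtain ⟨y, hly, h1, h2, h3, h4, h5⟩ := (hfreq.and_eventually
    ((eventually_eventually_nhds.2 hu).and (hs1.and (hs2.and ((eventually_mem_source hp hfix).and
      (c.open_target.mem_nhds hp)))))).exists
  -- Where `0 < l`, the map is locally this affine map; its linear part is a transvection of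
  -- determinant `1 + l.linear u`.
  obtain ⟨A, hA⟩ : ∃ A : (Fin n → ℝ) →ᵃ[ℝ] (Fin n → ℝ), A = AffineMap.id ℝ (Fin n → ℝ) +
    ((LinearMap.toSpanSingleton ℝ (Fin n → ℝ) u).toAffineMap.comp l) := ⟨_, rfl⟩
  have hlin : A.linear = LinearMap.transvection l.linear u := by
    rw [hA]
    ext
    simp [LinearMap.transvection]
  have hgerm : HasAffineGerm (fun y => c (h (c.symm y))) (c (c.symm y)) A := by
    rw [c.right_inv h5]
    have hpos : ∀ᶠ w : halfSpace n in 𝓝 y, 0 < l w :=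
      ((l.continuous_of_finiteDimensional).comp continuous_subtype_val).continuousAt.eventually
        (lt_mem_nhds hly)
    filter_upwards [h1, hpos] with w hw hw'
    rw [hw hw'.le, hA]
    simp
  have hsign := ho c hc c hc (c.symm y) (c.map_target h5) h4 A hgerm
  simp only [id_eq] at h2
  rw [h3, h2, hfix, hlin, LinearMap.transvection.det] at hsign
  have hne := o.sign_ne_zero c hc _ hps
  -- Both chart signs have been moved to the fixed point `c.symm p`, where they coincide and are
  -- nonzero, so they cancel.
  have : SignType.sign (1 + l.linear u) = 1 := by
    revert hsign hne
    generalize SignType.sign (1 + l.linear u) = a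
    generalize o.sign c (c.symm p) = b
    revert a b
    decide
  exact sign_eq_one_iff.1 this

variable [HasGroupoid M (plGroupoid n)]

/-- A finitely generated group acting on an oriented manifold and fixing pointwise a hypersurface,
but no nonempty open set, surjects onto `ℤ`. -/
theorem exists_surjective_int_of_submanifold {H : Subgroup (M ≃ₜ M)} {S : Set (M ≃ₜ M)}
    (hS : S.Finite) (hinv : ∀ h ∈ S, h⁻¹ ∈ S) (hSH : Subgroup.closure S = H)
    (hPL : ∀ h ∈ S, h ∈ PLHomeo n M) (o : PLOrientation n M) (ho : ∀ h ∈ S, o.Preserves h)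
    {K : Set M} (hK : IsPLSubmanifold n m K) (hKn : K.Nonempty) (hnm : n ≤ m + 1)
    (hKS : ∀ h ∈ S, ∀ x ∈ K, h x = x) (hint : interior {x | ∀ h ∈ S, h x = x} = ∅) :
    ∃ φ : H →* Multiplicative ℤ, Function.Surjective φ := by
  obtain ⟨c, hc, A, U, hU, ⟨v₀, hv₀⟩, hinj, hUK⟩ := hK.exists_affine_patch hKn
  obtain ⟨q, hqK, hqs, hqA⟩ := hUK v₀ hv₀
  have hmn : m ≤ n := by
    have := LinearMap.finrank_le_finrank_of_injective hinj
    simpa using this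
  obtain rfl | rfl : n = m ∨ n = m + 1 := by omega
  -- In codimension zero the patch is open and fixed, contradicting the empty interior.
  · exfalso
    have hopen : IsOpen (A '' U) := (AffineMap.isOpenMap_linear_iff.1
      (A.linear.isOpenMap_of_finiteDimensional (LinearMap.injective_iff_surjective.1 hinj))) U hU
    have hsub : c.source ∩ c ⁻¹' (Subtype.val ⁻¹' (A '' U)) ⊆ {x | ∀ h ∈ S, h x = x} := by
      rintro z ⟨hz, v, hv, hvz⟩ h hh
      obtain ⟨k, hk, hks, hkA⟩ := hUK v hv
      have : k = z := c.injOn hks hz (Subtype.ext (hkA.trans hvz))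
      exact this ▸ hKS h hh k hk
    have := interior_maximal hsub
      (c.isOpen_inter_preimage (hopen.preimage continuous_subtype_val))
      ⟨hqs, v₀, hv₀, hqA.symm⟩
    rw [hint] at this
    exact this
  · obtain ⟨L, hL, hbL, hwall⟩ := exists_common_walls hS hPL hc hqs (fun h hh => hKS h hh q hqK)
    obtain ⟨N, hN, hNw⟩ := (mem_nhds_induced _ _ _).1 hwall
    obtain ⟨W, hWN, hW, hqW⟩ := mem_nhds_iff.1 hN
    have hAc : Continuous A := A.continuous_of_finiteDimensional
    -- For this generic `v`, every wall through `A v` contains the whole hyperplane spanned by the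
    -- patch, hence is a multiple of its equation `l`.
    obtain ⟨v, ⟨hvU, hvW⟩, hvL⟩ := exists_forall_ne_zero
      (L := {d ∈ (fun a : (Fin (m + 1) → ℝ) →ᵃ[ℝ] ℝ => a.comp A) '' L | d ≠ 0})
      ((hL.image _).subset (sep_subset _ _)) (fun a ha => ha.2)
      (hU.inter (hW.preimage hAc)) ⟨v₀, hv₀, by rwa [mem_preimage, ← hqA]⟩
    obtain ⟨k, hkK, hks, hkA⟩ := hUK v hvU
    obtain ⟨p, hp⟩ : ∃ p, p = c k := ⟨_, rfl⟩
    have hpA : (p : Fin (m + 1) → ℝ) = A v := by rw [hp, hkA]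
    have hpt : p ∈ c.target := hp ▸ c.map_source hks
    have hpwall := hNw (show p ∈ _ from hWN (by rw [hpA]; exact hvW))
    have hpfix : ∀ h ∈ S, h (c.symm p) = c.symm p := by
      intro h hh
      rw [hp, c.left_inv hks, hKS h hh k hkK]
    have hrank : Module.finrank ℝ (LinearMap.range A.linear) = m := by
      rw [LinearMap.finrank_range_of_inj hinj]
      simp
    have hlt : LinearMap.range A.linear < ⊤ := by
      refine lt_top_iff_ne_top.2 fun h => ?_
      rw [h, finrank_top] at hrank
      simp at hrank
    obtain ⟨ℓ, hℓ, hle⟩ := Submodule.exists_le_ker_of_lt_top _ hlt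
    have hker : LinearMap.range A.linear = LinearMap.ker ℓ := by
      refine Submodule.eq_of_le_of_finrank_eq hle ?_
      have := Module.Dual.finrank_ker_add_one_of_ne_zero hℓ
      rw [Module.finrank_fin_fun] at this
      omega
    obtain ⟨l, hl⟩ : ∃ l : (Fin (m + 1) → ℝ) →ᵃ[ℝ] ℝ,
      l = ℓ.toAffineMap - AffineMap.const ℝ _ (ℓ p) := ⟨_, rfl⟩
    have hlval : ∀ y, l y = ℓ (y - p) := by intro y; rw [hl]; simp
    have hllin : l.linear = ℓ := by rw [hl]; simp
    have hlp : l p = 0 := by rw [hlval, sub_self, map_zero]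
    have hgen : ∀ a ∈ L, a p = 0 → ∃ r : ℝ, a = r • l := by
      intro a ha hap
      have hz : a.comp A = 0 := by
        by_contra hne
        exact hvL _ ⟨⟨a, ha, rfl⟩, hne⟩ (by rw [AffineMap.comp_apply, ← hpA, hap])
      have hle : ⨅ _ : Unit, LinearMap.ker ℓ ≤ LinearMap.ker a.linear := by
        rw [iInf_const, ← hker]
        rintro _ ⟨w, rfl⟩
        have := congrArg AffineMap.linear hz
        exact DFunLike.congr_fun this w
      have hspan := mem_span_of_iInf_ker_le_ker (L := fun _ : Unit => ℓ) hle
      rw [range_const, Submodule.mem_span_singleton] at hspan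
      obtain ⟨r, hr⟩ := hspan
      refine ⟨r, AffineMap.ext_linear (p := (p : Fin (m + 1) → ℝ)) ?_ ?_⟩
      · rw [AffineMap.smul_linear, hllin, hr]
      · simp [hap, hlp]
    have hfixwall : ∀ h ∈ S, ∀ᶠ y : halfSpace (m + 1) in 𝓝 p, l y = 0 →
        h (c.symm y) = c.symm y := by
      intro h hh
      -- A wall point `y` near `p` is the image under `A` of `v + g (y - p)`, which lies in `U`; so
      -- `y` is the chart image of a point of `K`. The scalar `1` below only fits the form of
      -- `map_add_smul`.
      obtain ⟨g, hg⟩ := A.linear.exists_leftInverse_of_injective (LinearMap.ker_eq_bot.2 hinj)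
      have hgc : Continuous g := g.continuous_of_finiteDimensional
      have hcont : Continuous fun y : halfSpace (m + 1) => v + (1 : ℝ) • g ((y : Fin (m + 1) → ℝ) - p) := by
        fun_prop
      have hev : ∀ᶠ y : halfSpace (m + 1) in 𝓝 p, v + (1 : ℝ) • g ((y : Fin (m + 1) → ℝ) - p) ∈ U :=
        hcont.continuousAt.eventually (by simpa using hU.mem_nhds hvU)
      filter_upwards [hev, c.open_target.mem_nhds hpt] with y hy hyt hly
      obtain ⟨k', hk', hks', hkA'⟩ := hUK _ hy
      have hmem : (y : Fin (m + 1) → ℝ) - p ∈ LinearMap.range A.linear := by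
        rw [hker, LinearMap.mem_ker, ← hlval, hly]
      obtain ⟨w, hw⟩ := hmem
      have hgw : g (A.linear w) = w := DFunLike.congr_fun hg w
      rw [map_add_smul, ← hw, hgw, hw, one_smul, ← hpA, add_sub_cancel] at hkA'
      have : c k' = y := Subtype.ext hkA'
      rw [← this, c.left_inv hks', hKS h hh k' hk']
    have main : ∀ l : (Fin (m + 1) → ℝ) →ᵃ[ℝ] ℝ, l p = 0 → l.linear ≠ 0 →
        (∀ a ∈ L, a p = 0 → ∃ r : ℝ, a = r • l) →
        (∀ h ∈ S, ∀ᶠ y : halfSpace (m + 1) in 𝓝 p, l y = 0 → h (c.symm y) = c.symm y) →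
        (∃ h ∈ S, ∃ᶠ y : halfSpace (m + 1) in 𝓝 p, 0 ≤ l y ∧ h (c.symm y) ≠ c.symm y) →
        ∃ φ : H →* Multiplicative ℤ, Function.Surjective φ :=
      fun l hlp hl hgen hfix hne => exists_surjective_int_of_wall hS hinv hSH hpt hlp hl
        (fun a ha => hgen a (hbL ha)) hfix (hpwall l hgen)
        (fun hfreq h hh u hu => (ho h hh).one_add_pos hc hpt (hpfix h hh) hfreq hu) hne
    obtain ⟨h, hh, hfr⟩ := not_forall_eventually_fixed (p := p) hS hpt (by rw [hint]; exact notMem_empty _)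
    have hsplit : ∃ᶠ y : halfSpace (m + 1) in 𝓝 p, (0 ≤ l y ∧ h (c.symm y) ≠ c.symm y) ∨
        (0 ≤ (-l) y ∧ h (c.symm y) ≠ c.symm y) := by
      refine hfr.mono fun y hy => ?_
      rcases le_total 0 (l y) with h0 | h0
      · exact Or.inl ⟨h0, hy⟩
      · exact Or.inr ⟨by simpa using h0, hy⟩
    rcases frequently_or_distrib.1 hsplit with hs | hs
    · exact main l hlp (hllin ▸ hℓ) hgen hfixwall ⟨h, hh, hs⟩
    · exact main (-l) (by simp [hlp]) (by simpa [hllin] using hℓ)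
        (fun a ha hap => (hgen a ha hap).imp' Neg.neg fun r hr => by rw [hr]; simp)
        (fun h hh => (hfixwall h hh).mono fun y hy h0 => hy (by simpa using h0)) ⟨h, hh, hs⟩

/-- The group `PL₊(M, K)` is locally indicable. -/
theorem isLocallyIndicable_PLPlus [T2Space M] [PreconnectedSpace M] (o : PLOrientation n M)
    {K : Set M} (hKn : K.Nonempty) (hK : IsPLSubmanifold n m K) (hnm : n ≤ m + 1) :
    IsLocallyIndicable (PLPlus o K) := by
  refine isLocallyIndicable_of_injective (PLPlus o K).subtype Subtype.val_injective ?_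
  intro H hle hfg hH
  rw [Subgroup.range_subtype] at hle
  obtain ⟨S, hS, hinv, hSH⟩ := exists_finite_symmetric_closure hfg
  have hSle : ∀ h ∈ S, h ∈ PLPlus o K := fun h hh => hle (hSH ▸ Subgroup.subset_closure hh)
  rcases (interior {x : M | ∀ h ∈ S, h x = x}).eq_empty_or_nonempty with hint | hint
  · exact exists_surjective_int_of_submanifold hS hinv hSH (fun h hh => (hSle h hh).1) o
      (fun h hh => (hSle h hh).2.1) hK hKn hnm (fun h hh => (hSle h hh).2.2) hint
  · exact exists_surjective_int_of_interior hS hinv hSH (fun h hh => (hSle h hh).1) hH hint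

end PLTop

/-! ### The cube: extension by the identity -/

namespace PLTop

/-- The affine functionals that are nonpositive on, and cut out the faces of, the cube `[1, 3]ⁿ`. -/
def cubeFaces (n : ℕ) : Set ((Fin n → ℝ) →ᵃ[ℝ] ℝ) :=
  range (fun i : Fin n => (LinearMap.proj i : (Fin n → ℝ) →ₗ[ℝ] ℝ).toAffineMap -
    AffineMap.const ℝ _ 3) ∪
  range (fun i : Fin n => AffineMap.const ℝ _ 1 -
    (LinearMap.proj i : (Fin n → ℝ) →ₗ[ℝ] ℝ).toAffineMap)

theorem finite_cubeFaces (n : ℕ) : (cubeFaces n).Finite := (finite_range _).union (finite_range _)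

theorem sub_two_mem_cube {n : ℕ} {z : Fin n → ℝ} :
    z - 2 ∈ cube n ↔ ∀ a ∈ cubeFaces n, a z ≤ 0 := by
  simp only [cube, mem_Icc, Pi.le_def, Pi.neg_apply, Pi.sub_apply, Pi.ofNat_apply]
  constructor
  · rintro ⟨h1, h2⟩ a (⟨i, rfl⟩ | ⟨i, rfl⟩)
    · have := h2 i
      simp
      linarith
    · have := h1 i
      simp
      linarith
  · intro h
    refine ⟨fun i => ?_, fun i => ?_⟩
    · have := h _ (Or.inr ⟨i, rfl⟩)
      simp at this
      linarith
    · have := h _ (Or.inl ⟨i, rfl⟩)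
      simp at this
      linarith

/-- Dilating by `1 + t` about the centre pushes a point on a face out of the cube. -/
theorem sub_two_mem_frontier {n : ℕ} {z : Fin n → ℝ} (hz : z - 2 ∈ cube n)
    {a : (Fin n → ℝ) →ᵃ[ℝ] ℝ} (ha : a ∈ cubeFaces n) (haz : 0 ≤ a z) :
    z - 2 ∈ frontier (cube n) := by
  rw [frontier_eq_closure_inter_closure]
  refine ⟨subset_closure hz, mem_closure_of_tendsto (tendsto_add_smul (z - 2) (z - 2)) ?_⟩
  filter_upwards [self_mem_nhdsWithin] with t ht hmem
  have ht : 0 < t := ht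
  rw [cube, mem_Icc, Pi.le_def, Pi.le_def] at hmem
  obtain ⟨h1, h2⟩ := hmem
  rcases ha with ⟨i, rfl⟩ | ⟨i, rfl⟩
  · have := h2 i
    simp at this haz
    nlinarith
  · have := h1 i
    simp at this haz
    nlinarith

theorem isPolyhedron_cube_shift (n : ℕ) : IsPolyhedron {z : Fin n → ℝ | z - 2 ∈ cube n} := by
  refine ⟨Neg.neg '' cubeFaces n, (finite_cubeFaces n).image _, ?_⟩
  ext z
  rw [mem_ofPred_eq, sub_two_mem_cube, mem_ofPred_eq, forall_mem_image]
  simp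

theorem add_two_mem_halfSpace {n : ℕ} {x : Fin n → ℝ} (hx : x ∈ cube n) : x + 2 ∈ halfSpace n := by
  intro i _
  have := hx.1 i
  simp only [Pi.neg_apply, Pi.add_apply, Pi.ofNat_apply] at this ⊢
  linarith

open Classical in
/-- The extension by the identity of a self-map of the cube, translated to `[1, 3]ⁿ`, to the
half-space. -/
noncomputable def cubeExtend {n : ℕ} (f : cube n → cube n) (y : halfSpace n) : halfSpace n :=
  if h : (y : Fin n → ℝ) - 2 ∈ cube n then
    ⟨f ⟨_, h⟩ + 2, add_two_mem_halfSpace (f ⟨_, h⟩).2⟩ else y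

theorem cubeExtend_of_mem {n : ℕ} (f : cube n → cube n) {y : halfSpace n}
    (h : (y : Fin n → ℝ) - 2 ∈ cube n) : (cubeExtend f y : Fin n → ℝ) = f ⟨_, h⟩ + 2 := by
  rw [cubeExtend, dif_pos h]

theorem cubeExtend_of_notMem {n : ℕ} (f : cube n → cube n) {y : halfSpace n}
    (h : (y : Fin n → ℝ) - 2 ∉ cube n) : cubeExtend f y = y := by
  rw [cubeExtend, dif_neg h]

theorem cubeExtend_id {n : ℕ} (y : halfSpace n) : cubeExtend id y = y := by
  by_cases h : (y : Fin n → ℝ) - 2 ∈ cube n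
  · exact Subtype.ext (by rw [cubeExtend_of_mem _ h]; simp)
  · exact cubeExtend_of_notMem _ h

theorem cubeExtend_comp {n : ℕ} (f g : cube n → cube n) (y : halfSpace n) :
    cubeExtend (f ∘ g) y = cubeExtend f (cubeExtend g y) := by
  by_cases h : (y : Fin n → ℝ) - 2 ∈ cube n
  · have e : (cubeExtend g y : Fin n → ℝ) - 2 = g ⟨_, h⟩ := by
      rw [cubeExtend_of_mem _ h, add_sub_cancel_right]
    have h' : (cubeExtend g y : Fin n → ℝ) - 2 ∈ cube n := e ▸ (g ⟨_, h⟩).2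
    refine Subtype.ext ?_
    rw [cubeExtend_of_mem _ h, cubeExtend_of_mem _ h']
    have : (⟨_, h'⟩ : cube n) = g ⟨_, h⟩ := Subtype.ext e
    rw [this]
    rfl
  · rw [cubeExtend_of_notMem _ h, cubeExtend_of_notMem _ h, cubeExtend_of_notMem _ h]

/-- Near a point of the cube, the pieces are those of `f` cut down to the cube, together with the
outer half-space of each face. On such a half-space the extension is the identity, since the cube
meets it only in frontier points, which `f` fixes. -/
theorem isPLAt_cubeExtend {n : ℕ} {f : cube n → cube n} (hf : ∀ x, IsPLAt f x)
    (hfix : ∀ x : cube n, (x : Fin n → ℝ) ∈ frontier (cube n) → f x = x) (y : halfSpace n) :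
    IsPLAt (cubeExtend f) y := by
  have hc : Continuous fun z : halfSpace n => (z : Fin n → ℝ) - 2 :=
    continuous_subtype_val.sub continuous_const
  by_cases hy : (y : Fin n → ℝ) - 2 ∈ cube n
  · obtain ⟨F, h1, h2, h3, h4⟩ := hf ⟨_, hy⟩
    have htrans : ∀ Q : cube n → Prop, (∀ᶠ x in 𝓝 (⟨_, hy⟩ : cube n), Q x) →
        ∀ᶠ z : halfSpace n in 𝓝 y, ∀ h : (z : Fin n → ℝ) - 2 ∈ cube n, Q ⟨_, h⟩ := by
      intro Q hQ
      obtain ⟨V, hV, hVQ⟩ := (mem_nhds_induced _ _ _).1 hQ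
      filter_upwards [hc.continuousAt hV] with z hz h
      exact hVQ (show (⟨_, h⟩ : cube n) ∈ _ from hz)
    let T : (Fin n → ℝ) →ᵃ[ℝ] (Fin n → ℝ) := AffineMap.id ℝ _ - AffineMap.const ℝ _ 2
    have hT : ∀ z, T z = z - 2 := fun z => rfl
    refine ⟨(fun P => {z : Fin n → ℝ | z - 2 ∈ cube n} ∩ T ⁻¹' P) '' F ∪
      (fun a : (Fin n → ℝ) →ᵃ[ℝ] ℝ => {z : Fin n → ℝ | 0 ≤ a z}) '' cubeFaces n,
      (h1.image _).union ((finite_cubeFaces n).image _), ?_, ?_, ?_⟩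
    · rintro _ (⟨P, hP, rfl⟩ | ⟨a, ha, rfl⟩)
      · exact (isPolyhedron_cube_shift n).inter_preimage (h2 P hP) T
      · exact ⟨{a}, finite_singleton a, by simp⟩
    · rintro _ (⟨P, hP, rfl⟩ | ⟨a, ha, rfl⟩)
      · obtain ⟨A, hA⟩ := h3 P hP
        refine ⟨A.comp T + AffineMap.const ℝ _ 2, ?_⟩
        filter_upwards [htrans _ hA] with z hz hzP
        rw [cubeExtend_of_mem _ hzP.1, hz hzP.1 hzP.2]
        rfl
      · refine ⟨AffineMap.id ℝ _, Eventually.of_forall fun z hz => ?_⟩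
        by_cases hzc : (z : Fin n → ℝ) - 2 ∈ cube n
        · rw [cubeExtend_of_mem _ hzc, hfix _ (sub_two_mem_frontier hzc ha hz)]
          simp
        · rw [cubeExtend_of_notMem _ hzc]
          rfl
    · filter_upwards [htrans _ h4] with z hz
      by_cases hzc : (z : Fin n → ℝ) - 2 ∈ cube n
      · obtain ⟨P, hP, hzP⟩ := hz hzc
        exact ⟨_, Or.inl ⟨P, hP, rfl⟩, hzc, hzP⟩
      · have := mt sub_two_mem_cube.2 hzc
        push Not at this
        obtain ⟨a, ha, haz⟩ := this
        exact ⟨_, Or.inr ⟨a, ha, rfl⟩, haz.le⟩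
  · refine (isPLAt_id y).congr ?_
    have hcl : IsClosed (cube n) := isClosed_Icc
    filter_upwards [hc.continuousAt (hcl.isOpen_compl.mem_nhds hy)] with z hz
    exact cubeExtend_of_notMem _ hz

theorem mem_PLHomeo_halfSpace {n : ℕ} {f : halfSpace n ≃ₜ halfSpace n} (hf : ∀ x, IsPLAt f x)
    (hf' : ∀ x, IsPLAt f.symm x) : f ∈ PLHomeo n (halfSpace n) := by
  intro c hc c' hc'
  rw [chartedSpaceSelf_atlas] at hc hc'
  subst hc hc'
  exact ⟨fun x _ => hf x, fun x _ => hf' x⟩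

/-- Extension by the identity, as a homomorphism from `PL(Iⁿ, ∂Iⁿ)`. -/
noncomputable def cubeExtendHom (n : ℕ) : PLCube n →* (halfSpace n ≃ₜ halfSpace n) where
  toFun f :=
    { toFun := cubeExtend f.1
      invFun := cubeExtend f.1.symm
      left_inv := fun y => by
        rw [← cubeExtend_comp, f.1.symm_comp_self, cubeExtend_id]
      right_inv := fun y => by
        rw [← cubeExtend_comp, f.1.self_comp_symm, cubeExtend_id]
      continuous_toFun := continuous_iff_continuousAt.2 fun y =>
        (isPLAt_cubeExtend f.2.1 f.2.2.2 y).continuousAt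
      continuous_invFun := continuous_iff_continuousAt.2 fun y =>
        (isPLAt_cubeExtend f⁻¹.2.1 f⁻¹.2.2.2 y).continuousAt }
  map_one' := Homeomorph.ext fun y => cubeExtend_id y
  map_mul' f g := Homeomorph.ext fun y => cubeExtend_comp f.1 g.1 y

theorem cubeExtendHom_injective (n : ℕ) : Function.Injective (cubeExtendHom n) := by
  intro f g hfg
  refine Subtype.ext (Homeomorph.ext fun x => Subtype.ext ?_)
  have hx : ((x : Fin n → ℝ) + 2) - 2 ∈ cube n := by rw [add_sub_cancel_right]; exact x.2
  have h := congrArg Subtype.val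
    (DFunLike.congr_fun hfg (⟨x + 2, add_two_mem_halfSpace x.2⟩ : halfSpace n))
  change (cubeExtend f.1 _ : Fin n → ℝ) = cubeExtend g.1 _ at h
  rw [cubeExtend_of_mem _ hx, cubeExtend_of_mem _ hx] at h
  have e : (⟨_, hx⟩ : cube n) = x := Subtype.ext (add_sub_cancel_right _ _)
  rw [e] at h
  exact add_right_cancel h

theorem cubeExtendHom_mem (n : ℕ) (f : PLCube n) : cubeExtendHom n f ∈ PLHomeo n (halfSpace n) :=
  mem_PLHomeo_halfSpace (isPLAt_cubeExtend f.2.1 f.2.2.2) (isPLAt_cubeExtend f⁻¹.2.1 f⁻¹.2.2.2)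

theorem convex_halfSpace (n : ℕ) : Convex ℝ (halfSpace n) := by
  intro x hx y hy a b ha hb _ i hi
  exact add_nonneg (mul_nonneg ha (hx i hi)) (mul_nonneg hb (hy i hi))

/-- The group `PL(Iⁿ, ∂Iⁿ)` is locally indicable. -/
theorem isLocallyIndicable_PLCube (n : ℕ) : IsLocallyIndicable (PLCube n) := by
  refine isLocallyIndicable_of_injective (cubeExtendHom n) (cubeExtendHom_injective n) ?_
  intro H hle hfg hH
  obtain ⟨S, hS, hinv, hSH⟩ := exists_finite_symmetric_closure hfg
  have hSle : ∀ h ∈ S, ∃ f, cubeExtendHom n f = h :=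
    fun h hh => hle (hSH ▸ Subgroup.subset_closure hh)
  have hpre : PreconnectedSpace (halfSpace n) :=
    isPreconnected_iff_preconnectedSpace.1 (convex_halfSpace n).isPreconnected
  -- For `n = 0` the half-space is a point and `H` would be trivial.
  have hn : 0 < n := by
    by_contra! h0
    obtain rfl : n = 0 := by omega
    refine hH ((Subgroup.eq_bot_iff_forall H).2 fun h _ => Homeomorph.ext fun x => ?_)
    exact Subtype.ext (Subsingleton.elim _ _)
  -- All extensions fix the open complement of the cube, so the first case applies and no
  -- orientation is needed.
  refine exists_surjective_int_of_interior (n := n) hS hinv hSH (fun h hh => ?_) hH ?_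
  · obtain ⟨f, rfl⟩ := hSle h hh
    exact cubeExtendHom_mem n f
  · have hopen : IsOpen {y : halfSpace n | (y : Fin n → ℝ) - 2 ∉ cube n} := by
      have hcl : IsClosed (cube n) := isClosed_Icc
      exact hcl.isOpen_compl.preimage (continuous_subtype_val.sub continuous_const)
    -- Any constant above `3` lies outside the translated cube `[1, 3]ⁿ`.
    have hmem : (fun _ => 5 : Fin n → ℝ) ∈ halfSpace n := fun i _ => by norm_num
    refine ⟨⟨_, hmem⟩, interior_maximal ?_ hopen ?_⟩
    · intro y hy h hh
      obtain ⟨f, rfl⟩ := hSle h hh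
      exact cubeExtend_of_notMem _ hy
    · intro h
      have := h.2 ⟨0, hn⟩
      simp only [Pi.sub_apply, Pi.ofNat_apply] at this
      norm_num at this

end PLTop

theorem mainTheorem1 :
    (∀ (n m : ℕ) (M : Type*) [TopologicalSpace M] [T2Space M] [ConnectedSpace M]
        [ChartedSpace (PLTop.halfSpace n) M] [HasGroupoid M (PLTop.plGroupoid n)]
        (o : PLTop.PLOrientation n M) (K : Set M),
        K.Nonempty → IsClosed K → PLTop.IsPLSubmanifold n m K → n ≤ m + 1 →
        IsLocallyIndicable (PLTop.PLPlus o K) ∧ IsLeftOrderable (PLTop.PLPlus o K)) ∧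
    ∀ n : ℕ, IsLocallyIndicable (PLTop.PLCube n) ∧ IsLeftOrderable (PLTop.PLCube n) := by
  refine ⟨fun n m M _ _ _ _ _ o K hKn _ hK hnm => ?_, fun n => ?_⟩
  · have h := PLTop.isLocallyIndicable_PLPlus o hKn hK hnm
    exact ⟨h, h.isLeftOrderable⟩
  · have h := PLTop.isLocallyIndicable_PLCube n
    exact ⟨h, h.isLeftOrderable⟩
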